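/- Fix one of the three settings $k\in\{\mathbb E_1,\mathbb E_2,\mathbb E_\infty\}$ (monoidal, braided monoidal, symmetric monoidal). "Functor" and "natural transformation" below are (strong) monoidal, braided when $k\neq\mathbb E_1$. **Dagger categories.** $\mathrm{Cat}^\dagger_k$ is the strict 2-category of dagger categories $D$ with a $k$-monoidal structure such that $(f\otimes g)^\dagger=f^\dagger\otimes g^\dagger$ and the associator, the unitors and the braiding (if any) are unitary. Its 1-morphisms are the $k$-monoidal functors $F$ with $F(f^\dagger)=F(f)^\dagger$ whose structure isomorphisms $1\to F1$, $Fx\otimes Fy\to F(x\otimes y)$ are unitary; its 2-morphisms are the monoidal natural transformations with isometric components ($\tau_x^\dagger\tau_x=\mathrm{id}$). **Anti-involutive categories.** $\mathrm{aICat}_k$ is the strict 2-category of $k$-monoidal categories $C$ with a $k$-monoidal functor $d\colon C\to C^{\mathrm{op}}$ (with data $u\colon 1\cong d1$ and $\chi_{x,y}\colon dx\otimes dy\cong d(x\otimes y)$; $C^{\mathrm{op}}$ has the inverse braiding) and a monoidal natural isomorphism $\eta\colon\mathrm{id}\cong d^2$ with $d(\eta_c)\circ\eta_{dc}=\mathrm{id}_{dc}$.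 Its 1-morphisms are the $k$-monoidal functors $F$ with a monoidal natural isomorphism $\varphi_x\colon F(dx)\cong d(Fx)$ satisfying $\varphi_{dx}\circ F(\eta_x)=d(\varphi_x)\circ\eta_{Fx}$; its 2-morphisms $(F,\varphi)\to(G,\psi)$ are the monoidal natural transformations $\tau$ with $\varphi_x=d(\tau_x)\circ\psi_x\circ\tau_{dx}$. The canonical ("forgetful") 2-functor $\mathrm{Cat}^\dagger_k\to\mathrm{aICat}_k$ regards $D$ as anti-involutive with $d=\dagger$ and $\eta,u,\chi$ identities, and $F$ as anti-involutive with $\varphi=\mathrm{id}$. **Hermitian completion.** A Hermitian pairing on $c\in C$ is an isomorphism $h\colon c\to dc$ with $d(h)\circ\eta_c=h$. $\operatorname{Herm}C$ has as objects the pairs $(c,h)$ with $h$ a Hermitian pairing on $c$; as morphisms $(c_1,h_1)\to(c_2,h_2)$ all morphisms $f\colon c_1\to c_2$; dagger $f^\dagger=h_1^{-1}\circ d(f)\circ h_2$; tensor product $(c,h)\otimes(c',h')=(c\otimes c',\chi_{c,c'}\circ(h\otimes h'))$; unit $(1,u)$; and the associator, unitors and braiding of $C$. A 1-morphism $(F,\varphi)$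 induces $(c,h)\mapsto(Fc,\varphi_c\circ F(h))$, $f\mapsto F(f)$, with the monoidal structure isomorphisms of $F$; a 2-morphism $\tau$ induces $\tau$. **Positivity structures.** A monoidal positivity structure $P$ on $C$ is a collection of objects of $\operatorname{Herm}C$ such that every $c\in C$ has some $(c,h)\in P$; that is closed under transfer: if $(c,h)\in P$ and $g\colon c'\to c$ is an isomorphism, then $(c',\,d(g)\circ h\circ g)\in P$; and that is closed under $\otimes$. (It then contains $(1,u)$.) Let $C_P\subseteq\operatorname{Herm}C$ be the full dagger subcategory on $P$. $(\mathrm{aICat}_k)_P$ is the strict 2-category of pairs $(C,P)$, whose 1-morphisms are the 1-morphisms $(F,\varphi)$ of $\mathrm{aICat}_k$ that send positive pairings to positive pairings, $(c,h)\in P\Rightarrow(Fc,\varphi_c\circ F(h))\in P'$, and whose 2-morphisms are all 2-morphisms between these. For $D\in\mathrm{Cat}^\dagger_k$ let $\operatorname{Pos}(D)$ be the positivity structure on $D$, regarded as anti-involutive, of all pairings $g^\dagger\circ g$ with $g$ an isomorphism of $D$ with source $c$. **Theorem.** For each of $k=\mathbb E_1,\mathbb E_2,\mathbb E_\infty$: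 1. The assignments above on objects, 1-morphisms and 2-morphisms make $\operatorname{Herm}\colon\mathrm{aICat}_k\to\mathrm{Cat}^\dagger_k$ a strict 2-functor, and it is strictly right adjoint to the canonical 2-functor $\mathrm{Cat}^\dagger_k\to\mathrm{aICat}_k$: there are strictly 2-natural unit and counit satisfying the triangle identities on the nose. 2. It restricts to a strict 2-functor $(\mathrm{aICat}_k)_P\to\mathrm{Cat}^\dagger_k$, $(C,P)\mapsto C_P$. This is strictly right adjoint to the strict 2-functor $\mathrm{Cat}^\dagger_k\to(\mathrm{aICat}_k)_P$, $D\mapsto(D,\operatorname{Pos}(D))$ (given by the canonical 2-functor on 1- and 2-morphisms), by an adjunction all of whose unit and counit components are equivalences in the respective 2-categories. In particular $\mathrm{Cat}^\dagger_k$ and $(\mathrm{aICat}_k)_P$ are 2-equivalent. -/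

import Mathlib

open CategoryTheory MonoidalCategory Opposite

universe v u v₁ u₁ v₂ u₂

namespace DaggerHerm

/-! ### Dagger categories -/

/-- A dagger structure on `C`: an identity-on-objects functor `Cᵒᵖ ⥤ C` squaring to the identity. -/
class DaggerCategory (C : Type u) [Category.{v} C] where
  dag : ∀ {X Y : C}, (X ⟶ Y) → (Y ⟶ X)
  dag_id : ∀ X : C, dag (𝟙 X) = 𝟙 X
  dag_comp : ∀ {X Y Z : C} (f : X ⟶ Y) (g : Y ⟶ Z), dag (f ≫ g) = dag g ≫ dag f
  dag_dag : ∀ {X Y : C} (f : X ⟶ Y), dag (dag f) = f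

open DaggerCategory (dag dag_id dag_comp dag_dag)

section

variable {C : Type u} [Category.{v} C] [DaggerCategory C]

/-- `f` is an isometry: `f† ∘ f = id`. -/
def IsIsometry {X Y : C} (f : X ⟶ Y) : Prop := f ≫ dag f = 𝟙 X

/-- `f` is unitary: `f† ∘ f = id` and `f ∘ f† = id`. -/
def IsUnitary {X Y : C} (f : X ⟶ Y) : Prop := f ≫ dag f = 𝟙 X ∧ dag f ≫ f = 𝟙 Y

/-- An endomorphism is iso-positive if it is of the form `g† ∘ g` for some isomorphism `g`. -/
def IsIsoPositive {X : C} (f : X ⟶ X) : Prop := ∃ (Y : C) (g : X ≅ Y), f = g.hom ≫ dag g.hom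

end

/-- The compatibility making a monoidal category with a dagger a monoidal dagger category. -/
class MonoidalDagger (C : Type u) [Category.{v} C] [MonoidalCategory C] [DaggerCategory C] :
    Prop where
  dag_tensorHom : ∀ {X₁ Y₁ X₂ Y₂ : C} (f : X₁ ⟶ Y₁) (g : X₂ ⟶ Y₂),
    dag (f ⊗ₘ g) = dag f ⊗ₘ dag g
  unitary_associator : ∀ X Y Z : C, IsUnitary (α_ X Y Z).hom
  unitary_leftUnitor : ∀ X : C, IsUnitary (λ_ X).hom
  unitary_rightUnitor : ∀ X : C, IsUnitary (ρ_ X).hom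

/-! ### Anti-involutive categories and Hermitian pairings -/

/-- An anti-involution on `C`: a contravariant functor `d` (written as a functor `Cᵒᵖ ⥤ C`) and a
natural isomorphism `η : id ≅ d ∘ d` such that `d(η_c)` is the inverse of `η_{dc}`. -/
class AntiInvolution (C : Type u) [Category.{v} C] where
  d : Cᵒᵖ ⥤ C
  eta : 𝟭 C ≅ d.rightOp ⋙ d
  eta_d : ∀ c : C, eta.hom.app (d.obj (op c)) ≫ d.map (eta.hom.app c).op = 𝟙 (d.obj (op c))

section

variable {C : Type u} [Category.{v} C] [AntiInvolution C]

/-- `d` on objects. -/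
abbrev dObj (X : C) : C := AntiInvolution.d.obj (op X)

/-- `d` on morphisms. -/
abbrev dMap {X Y : C} (f : X ⟶ Y) : dObj Y ⟶ dObj X := AntiInvolution.d.map f.op

/-- The components of `η`. -/
abbrev etaApp (X : C) : X ⟶ dObj (dObj X) := AntiInvolution.eta.hom.app X

lemma dMap_id (X : C) : dMap (𝟙 X) = 𝟙 (dObj X) := by simp [dMap]

lemma dMap_comp {X Y Z : C} (f : X ⟶ Y) (g : Y ⟶ Z) : dMap (f ≫ g) = dMap g ≫ dMap f := by
  simp [dMap]

lemma eta_natural {X Y : C} (f : X ⟶ Y) : f ≫ etaApp Y = etaApp X ≫ dMap (dMap f) :=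
  AntiInvolution.eta.hom.naturality f

lemma etaApp_dMap (X : C) : etaApp (dObj X) ≫ dMap (etaApp X) = 𝟙 (dObj X) :=
  AntiInvolution.eta_d X

instance isIso_dMap {X Y : C} (f : X ⟶ Y) [IsIso f] : IsIso (dMap f) := by
  unfold dMap; infer_instance

end

/-- The condition that an isomorphism `h : c ≅ dc` is a Hermitian pairing. -/
def IsHermitian {C : Type u} [Category.{v} C] [AntiInvolution C] {c : C} (h : c ≅ dObj c) : Prop :=
  etaApp c ≫ dMap h.hom = h.hom

/-- Objects of the Hermitian completion `Herm C`: objects with a Hermitian pairing. -/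
@[ext]
structure Herm (C : Type u) [Category.{v} C] [AntiInvolution C] where
  obj : C
  pairing : obj ≅ dObj obj
  hermitian : IsHermitian pairing

namespace Herm

section

variable {C : Type u} [Category.{v} C] [AntiInvolution C]

/-- Morphisms of the Hermitian completion: all morphisms between the underlying objects. -/
@[ext]
structure Hom (X Y : Herm C) where
  hom : X.obj ⟶ Y.obj

instance category : Category.{v} (Herm C) where
  Hom X Y := Hom X Y
  id X := ⟨𝟙 X.obj⟩
  comp f g := ⟨f.hom ≫ g.hom⟩

@[ext]
lemma hom_ext {X Y : Herm C} {f g : X ⟶ Y} (h : f.hom = g.hom) : f = g := Hom.ext h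

@[simp] lemma id_hom (X : Herm C) : Hom.hom (𝟙 X) = 𝟙 X.obj := rfl

@[simp] lemma comp_hom {X Y Z : Herm C} (f : X ⟶ Y) (g : Y ⟶ Z) :
    (f ≫ g).hom = f.hom ≫ g.hom := rfl

/-- An isomorphism of underlying objects gives an isomorphism in the Hermitian completion. -/
@[simps]
def isoMk {X Y : Herm C} (e : X.obj ≅ Y.obj) : X ≅ Y where
  hom := ⟨e.hom⟩
  inv := ⟨e.inv⟩

variable (C) in
/-- The functor forgetting the Hermitian pairing. -/
@[simps]
def forget : Herm C ⥤ C where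
  obj X := X.obj
  map f := f.hom

instance : (forget C).Faithful where
  map_injective h := hom_ext h

lemma pairing_dMap (X : Herm C) : etaApp X.obj ≫ dMap X.pairing.hom = X.pairing.hom := X.hermitian

lemma pairing_inv_eta (X : Herm C) : X.pairing.inv ≫ etaApp X.obj = inv (dMap X.pairing.hom) := by
  rw [Iso.inv_comp_eq, IsIso.eq_comp_inv, pairing_dMap]

/-- The dagger of `f : (c₁, h₁) ⟶ (c₂, h₂)` is `h₁⁻¹ ∘ d f ∘ h₂`. -/
instance dagger : DaggerCategory (Herm C) where
  dag {X Y} f := ⟨Y.pairing.hom ≫ dMap f.hom ≫ X.pairing.inv⟩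
  dag_id X := by ext; simp [dMap_id]
  dag_comp f g := by ext; simp [dMap_comp]
  dag_dag {X Y} f := by
    ext
    have e : dMap (Y.pairing.hom ≫ dMap f.hom ≫ X.pairing.inv) =
        dMap X.pairing.inv ≫ dMap (dMap f.hom) ≫ dMap Y.pairing.hom := by
      simp only [dMap_comp, Category.assoc]
    have e2 : dMap X.pairing.inv = inv (dMap X.pairing.hom) := by
      apply IsIso.eq_inv_of_hom_inv_id
      rw [← dMap_comp, Iso.inv_hom_id, dMap_id]
    dsimp only
    rw [e, e2, ← pairing_inv_eta]
    simp only [Category.assoc, Iso.hom_inv_id_assoc]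
    rw [← reassoc_of% (eta_natural f.hom), reassoc_of% (pairing_dMap Y), Iso.hom_inv_id,
      Category.comp_id]

lemma dag_hom {X Y : Herm C} (f : X ⟶ Y) :
    (dag f).hom = Y.pairing.hom ≫ dMap f.hom ≫ X.pairing.inv := rfl

lemma isUnitary_iff_of_iso {X Y : Herm C} (f : X ≅ Y) :
    IsUnitary f.hom ↔ f.hom.hom ≫ Y.pairing.hom ≫ dMap f.hom.hom = X.pairing.hom := by
  have key : f.hom ≫ dag f.hom = 𝟙 X ↔
      f.hom.hom ≫ Y.pairing.hom ≫ dMap f.hom.hom = X.pairing.hom := by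
    rw [← cancel_mono X.pairing.inv]
    simp only [Category.assoc, Iso.hom_inv_id]
    exact ⟨fun h => congrArg Hom.hom h, fun h => hom_ext h⟩
  constructor
  · exact fun h => key.1 h.1
  · intro h
    have h1 := key.2 h
    refine ⟨h1, ?_⟩
    have h2 : dag f.hom = f.inv := by rw [← cancel_epi f.hom, h1, Iso.hom_inv_id]
    rw [h2, Iso.inv_hom_id]

/-- The transfer of a Hermitian pairing `h` on `c` along an isomorphism `g : c' ≅ c`: the Hermitian
pairing `d g ∘ h ∘ g` on `c'`. -/
@[simps]
def transfer (X : Herm C) {c : C} (g : c ≅ X.obj) : Herm C where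
  obj := c
  pairing :=
    { hom := g.hom ≫ X.pairing.hom ≫ dMap g.hom
      inv := dMap g.inv ≫ X.pairing.inv ≫ g.inv
      hom_inv_id := by
        simp only [Category.assoc]
        rw [← reassoc_of% (dMap_comp g.inv g.hom)]
        simp [dMap_id]
      inv_hom_id := by
        simp only [Category.assoc, Iso.inv_hom_id_assoc]
        rw [← dMap_comp]
        simp [dMap_id] }
  hermitian := by
    change etaApp c ≫ dMap (g.hom ≫ X.pairing.hom ≫ dMap g.hom) = _
    simp only [dMap_comp, Category.assoc]
    rw [← reassoc_of% (eta_natural g.hom), reassoc_of% (pairing_dMap X)]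

end

end Herm

/-! ### Monoidal anti-involutions and the monoidal structure of the Hermitian completion -/

/-- A monoidal anti-involution: `d` is a strong monoidal functor and `η` is a monoidal natural
isomorphism. Here `Cᵒᵖ` carries the same tensor product as `C`. -/
class MonoidalAntiInvolution (C : Type u) [Category.{v} C] [MonoidalCategory C] extends
    AntiInvolution C where
  monoidal : d.Monoidal
  eta_unit : eta.hom.app (𝟙_ C) ≫ d.map (Functor.LaxMonoidal.ε d).op = Functor.LaxMonoidal.ε d
  eta_tensor : ∀ X Y : C,
    eta.hom.app (X ⊗ Y) ≫ d.map (Functor.LaxMonoidal.μ d (op X) (op Y)).op =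
      (eta.hom.app X ⊗ₘ eta.hom.app Y) ≫
        Functor.LaxMonoidal.μ d (op (d.obj (op X))) (op (d.obj (op Y)))

attribute [reducible, instance] MonoidalAntiInvolution.monoidal

section

variable {C : Type u} [Category.{v} C] [MonoidalCategory C] [MonoidalAntiInvolution C]

/-- The unit datum `u : 1 ≅ d 1` of `d`. -/
abbrev uIso (C : Type u) [Category.{v} C] [MonoidalCategory C] [MonoidalAntiInvolution C] :
    𝟙_ C ≅ dObj (𝟙_ C) :=
  Functor.Monoidal.εIso AntiInvolution.d

/-- The datum `χ : dX ⊗ dY ≅ d(X ⊗ Y)` of `d`. -/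
abbrev chi (X Y : C) : dObj X ⊗ dObj Y ≅ dObj (X ⊗ Y) :=
  Functor.Monoidal.μIso AntiInvolution.d (op X) (op Y)

lemma etaApp_unit : etaApp (𝟙_ C) ≫ dMap (uIso C).hom = (uIso C).hom :=
  MonoidalAntiInvolution.eta_unit

lemma etaApp_tensor (X Y : C) : etaApp (X ⊗ Y) ≫ dMap (chi X Y).hom =
    (etaApp X ⊗ₘ etaApp Y) ≫ (chi (dObj X) (dObj Y)).hom :=
  MonoidalAntiInvolution.eta_tensor X Y

lemma chi_natural {X X' Y Y' : C} (f : X ⟶ X') (g : Y ⟶ Y') :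
    (dMap f ⊗ₘ dMap g) ≫ (chi X Y).hom = (chi X' Y').hom ≫ dMap (f ⊗ₘ g) :=
  Functor.LaxMonoidal.μ_natural AntiInvolution.d f.op g.op

lemma chi_associativity (X Y Z : C) :
    ((chi X Y).hom ▷ dObj Z) ≫ (chi (X ⊗ Y) Z).hom ≫ dMap (α_ X Y Z).inv =
      (α_ (dObj X) (dObj Y) (dObj Z)).hom ≫ (dObj X ◁ (chi Y Z).hom) ≫ (chi X (Y ⊗ Z)).hom :=
  Functor.LaxMonoidal.associativity AntiInvolution.d (op X) (op Y) (op Z)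

lemma chi_left_unitality (X : C) : (λ_ (dObj X)).hom =
    ((uIso C).hom ▷ dObj X) ≫ (chi (𝟙_ C) X).hom ≫ dMap (λ_ X).inv :=
  Functor.LaxMonoidal.left_unitality AntiInvolution.d (op X)

lemma chi_right_unitality (X : C) : (ρ_ (dObj X)).hom =
    (dObj X ◁ (uIso C).hom) ≫ (chi X (𝟙_ C)).hom ≫ dMap (ρ_ X).inv :=
  Functor.LaxMonoidal.right_unitality AntiInvolution.d (op X)

end

namespace Herm

section

variable {C : Type u} [Category.{v} C] [MonoidalCategory C] [MonoidalAntiInvolution C]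

/-- The tensor product of Hermitian pairings: `χ ∘ (h₁ ⊗ h₂)`. -/
@[simps]
def tensor (X Y : Herm C) : Herm C where
  obj := X.obj ⊗ Y.obj
  pairing := (X.pairing ⊗ᵢ Y.pairing) ≪≫ chi X.obj Y.obj
  hermitian := by
    change etaApp (X.obj ⊗ Y.obj) ≫ dMap ((X.pairing.hom ⊗ₘ Y.pairing.hom) ≫ (chi _ _).hom) = _
    rw [dMap_comp, reassoc_of% (etaApp_tensor X.obj Y.obj), ← chi_natural, tensorHom_comp_tensorHom_assoc,
      pairing_dMap, pairing_dMap]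
    rfl

variable (C) in
/-- The monoidal unit with the Hermitian pairing `u : 1 ≅ d 1`. -/
@[simps]
def unit : Herm C where
  obj := 𝟙_ C
  pairing := uIso C
  hermitian := etaApp_unit

@[simps]
instance monoidalCategoryStruct : MonoidalCategoryStruct (Herm C) where
  tensorObj X Y := tensor X Y
  whiskerLeft X _ _ f := ⟨X.obj ◁ f.hom⟩
  whiskerRight f Y := ⟨f.hom ▷ Y.obj⟩
  tensorHom f g := ⟨f.hom ⊗ₘ g.hom⟩
  tensorUnit := unit C
  associator X Y Z := isoMk (α_ X.obj Y.obj Z.obj)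
  leftUnitor X := isoMk (λ_ X.obj)
  rightUnitor X := isoMk (ρ_ X.obj)

instance monoidalCategory : MonoidalCategory (Herm C) where
  tensorHom_def f g := hom_ext (tensorHom_def f.hom g.hom)
  id_tensorHom_id X Y := hom_ext (id_tensorHom_id X.obj Y.obj)
  tensorHom_comp_tensorHom f g h k := hom_ext (tensorHom_comp_tensorHom f.hom g.hom h.hom k.hom)
  whiskerLeft_id X Y := hom_ext (whiskerLeft_id X.obj Y.obj)
  id_whiskerRight X Y := hom_ext (id_whiskerRight X.obj Y.obj)
  associator_naturality f g h := hom_ext (associator_naturality f.hom g.hom h.hom)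
  leftUnitor_naturality f := hom_ext (leftUnitor_naturality f.hom)
  rightUnitor_naturality f := hom_ext (rightUnitor_naturality f.hom)
  pentagon W X Y Z := hom_ext (pentagon W.obj X.obj Y.obj Z.obj)
  triangle X Y := hom_ext (triangle X.obj Y.obj)

instance monoidalDagger : MonoidalDagger (Herm C) where
  dag_tensorHom {X₁ Y₁ X₂ Y₂} f g := by
    ext
    change ((Y₁.pairing.hom ⊗ₘ Y₂.pairing.hom) ≫ (chi _ _).hom) ≫ dMap (f.hom ⊗ₘ g.hom) ≫
      (chi X₁.obj X₂.obj).inv ≫ (X₁.pairing.inv ⊗ₘ X₂.pairing.inv) =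
      (Y₁.pairing.hom ≫ dMap f.hom ≫ X₁.pairing.inv) ⊗ₘ
        (Y₂.pairing.hom ≫ dMap g.hom ≫ X₂.pairing.inv)
    rw [Category.assoc, ← reassoc_of% (chi_natural f.hom g.hom), Iso.hom_inv_id_assoc]
    simp only [tensorHom_comp_tensorHom]
  unitary_associator X Y Z := by
    rw [isUnitary_iff_of_iso]
    change (α_ X.obj Y.obj Z.obj).hom ≫ ((X.pairing.hom ⊗ₘ ((Y.pairing.hom ⊗ₘ Z.pairing.hom) ≫
      (chi Y.obj Z.obj).hom)) ≫ (chi X.obj (Y.obj ⊗ Z.obj)).hom) ≫ dMap (α_ X.obj Y.obj Z.obj).hom =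
      ((((X.pairing.hom ⊗ₘ Y.pairing.hom) ≫ (chi X.obj Y.obj).hom) ⊗ₘ Z.pairing.hom) ≫
        (chi (X.obj ⊗ Y.obj) Z.obj).hom)
    have h := chi_associativity X.obj Y.obj Z.obj
    have h2 : dMap (α_ X.obj Y.obj Z.obj).inv ≫ dMap (α_ X.obj Y.obj Z.obj).hom = 𝟙 _ := by
      rw [← dMap_comp, Iso.hom_inv_id, dMap_id]
    have h3 : ((chi X.obj Y.obj).hom ▷ dObj Z.obj) ≫ (chi (X.obj ⊗ Y.obj) Z.obj).hom =
        (α_ _ _ _).hom ≫ (dObj X.obj ◁ (chi Y.obj Z.obj).hom) ≫ (chi X.obj (Y.obj ⊗ Z.obj)).hom ≫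
        dMap (α_ X.obj Y.obj Z.obj).hom := by
      rw [← reassoc_of% h, h2, Category.comp_id]
    have e1 : (((X.pairing.hom ⊗ₘ Y.pairing.hom) ≫ (chi X.obj Y.obj).hom) ⊗ₘ Z.pairing.hom) =
        ((X.pairing.hom ⊗ₘ Y.pairing.hom) ⊗ₘ Z.pairing.hom) ≫
          ((chi X.obj Y.obj).hom ▷ dObj Z.obj) := by
      rw [← tensorHom_id, tensorHom_comp_tensorHom, Category.comp_id]
    have e2 : (X.pairing.hom ⊗ₘ ((Y.pairing.hom ⊗ₘ Z.pairing.hom) ≫ (chi Y.obj Z.obj).hom)) =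
        (X.pairing.hom ⊗ₘ (Y.pairing.hom ⊗ₘ Z.pairing.hom)) ≫
          (dObj X.obj ◁ (chi Y.obj Z.obj).hom) := by
      rw [← id_tensorHom, tensorHom_comp_tensorHom, Category.comp_id]
    rw [e1, e2]
    simp only [Category.assoc]
    rw [h3, associator_naturality_assoc]
  unitary_leftUnitor X := by
    rw [isUnitary_iff_of_iso]
    change (λ_ X.obj).hom ≫ X.pairing.hom ≫ dMap (λ_ X.obj).hom =
      ((uIso C).hom ⊗ₘ X.pairing.hom) ≫ (chi (𝟙_ C) X.obj).hom
    have h2 : dMap (λ_ X.obj).inv ≫ dMap (λ_ X.obj).hom = 𝟙 _ := by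
      rw [← dMap_comp, Iso.hom_inv_id, dMap_id]
    rw [← leftUnitor_naturality_assoc, chi_left_unitality, Category.assoc, Category.assoc, h2,
      Category.comp_id, ← id_tensorHom, ← tensorHom_id, tensorHom_comp_tensorHom_assoc,
      Category.id_comp, Category.comp_id]
  unitary_rightUnitor X := by
    rw [isUnitary_iff_of_iso]
    change (ρ_ X.obj).hom ≫ X.pairing.hom ≫ dMap (ρ_ X.obj).hom =
      (X.pairing.hom ⊗ₘ (uIso C).hom) ≫ (chi X.obj (𝟙_ C)).hom
    have h2 : dMap (ρ_ X.obj).inv ≫ dMap (ρ_ X.obj).hom = 𝟙 _ := by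
      rw [← dMap_comp, Iso.hom_inv_id, dMap_id]
    rw [← rightUnitor_naturality_assoc, chi_right_unitality, Category.assoc, Category.assoc, h2,
      Category.comp_id, ← id_tensorHom, ← tensorHom_id, tensorHom_comp_tensorHom_assoc,
      Category.id_comp, Category.comp_id]

end

end Herm

/-! ### The three levels of commutativity -/

/-- The three settings: monoidal (`E1`), braided monoidal (`E2`) and symmetric monoidal (`Einf`). -/
inductive Level
  | E1
  | E2
  | Einf

/-- The levels at which a braiding is part of the structure. -/
def Level.IsBraided (k : Level) : Prop := k ≠ Level.E1

/-- The extra structure on a monoidal category at level `k`: nothing for `E1`, a braiding for `E2`,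
a symmetric braiding for `Einf`. -/
structure BraidingData (k : Level) (C : Type u) [Category.{v} C] [MonoidalCategory C] where
  braiding : k.IsBraided → BraidedCategory C
  symmetric : k = Level.Einf → ∀ (hk : k.IsBraided) (X Y : C),
    ((braiding hk).braiding X Y).hom ≫ ((braiding hk).braiding Y X).hom = 𝟙 (X ⊗ Y)

namespace BraidingData

variable {k : Level}

/-- The braiding `X ⊗ Y ≅ Y ⊗ X`. -/
def beta {C : Type u} [Category.{v} C] [MonoidalCategory C] (B : BraidingData k C)
    (hk : k.IsBraided) (X Y : C) : X ⊗ Y ≅ Y ⊗ X :=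
  (B.braiding hk).braiding X Y

/-- The braiding (if any) is unitary. -/
def IsUnitary {C : Type u} [Category.{v} C] [MonoidalCategory C] [DaggerCategory C]
    (B : BraidingData k C) : Prop :=
  ∀ (hk : k.IsBraided) (X Y : C), DaggerHerm.IsUnitary (B.beta hk X Y).hom

/-- The monoidal functor `d : C ⥤ Cᵒᵖ` is braided (if there is a braiding), where `Cᵒᵖ` carries the
inverse braiding. -/
def IsBraidedAntiInvolution {C : Type u} [Category.{v} C] [MonoidalCategory C]
    [MonoidalAntiInvolution C] (B : BraidingData k C) : Prop :=
  ∀ (hk : k.IsBraided) (X Y : C),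
    (chi X Y).hom ≫ dMap (B.beta hk X Y).inv = (B.beta hk (dObj X) (dObj Y)).hom ≫ (chi Y X).hom

/-- The monoidal functor `F` is braided (if there are braidings). -/
def IsPreservedBy {C : Type u₁} [Category.{v₁} C] [MonoidalCategory C] {D : Type u₂}
    [Category.{v₂} D] [MonoidalCategory D] (B : BraidingData k C) (B' : BraidingData k D)
    (F : C ⥤ D) [F.Monoidal] : Prop :=
  ∀ (hk : k.IsBraided) (X Y : C),
    Functor.LaxMonoidal.μ F X Y ≫ F.map (B.beta hk X Y).hom =
      (B'.beta hk (F.obj X) (F.obj Y)).hom ≫ Functor.LaxMonoidal.μ F Y X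

lemma isPreservedBy_id {C : Type u₁} [Category.{v₁} C] [MonoidalCategory C]
    (B : BraidingData k C) : B.IsPreservedBy B (𝟭 C) := by
  intro hk X Y
  simp

lemma isPreservedBy_comp {C : Type u₁} [Category.{v₁} C] [MonoidalCategory C] {D : Type u₁}
    [Category.{v₁} D] [MonoidalCategory D] {E : Type u₁} [Category.{v₁} E] [MonoidalCategory E]
    {B : BraidingData k C} {B' : BraidingData k D} {B'' : BraidingData k E}
    {F : C ⥤ D} {G : D ⥤ E} [F.Monoidal] [G.Monoidal] (hF : B.IsPreservedBy B' F)
    (hG : B'.IsPreservedBy B'' G) : B.IsPreservedBy B'' (F ⋙ G) := by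
  intro hk X Y
  have h1 := hF hk X Y
  have h2 := hG hk (F.obj X) (F.obj Y)
  simp only [Functor.LaxMonoidal.comp_μ, Functor.comp_map, Category.assoc, Functor.comp_obj]
  rw [← G.map_comp, h1, G.map_comp, reassoc_of% h2]

end BraidingData

namespace Herm

variable {k : Level} {C : Type u} [Category.{v} C] [MonoidalCategory C] [MonoidalAntiInvolution C]

/-- The braiding of the Hermitian completion is the braiding of the underlying category. -/
def braidingData (B : BraidingData k C) : BraidingData k (Herm C) where
  braiding hk :=
    letI := B.braiding hk
    { braiding := fun X Y => isoMk (β_ X.obj Y.obj)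
      braiding_naturality_right := fun X _ _ f =>
        hom_ext (BraidedCategory.braiding_naturality_right X.obj f.hom)
      braiding_naturality_left := fun f Z =>
        hom_ext (BraidedCategory.braiding_naturality_left f.hom Z.obj)
      hexagon_forward := fun X Y Z =>
        hom_ext (BraidedCategory.hexagon_forward X.obj Y.obj Z.obj)
      hexagon_reverse := fun X Y Z =>
        hom_ext (BraidedCategory.hexagon_reverse X.obj Y.obj Z.obj) }
  symmetric h hk X Y := hom_ext (B.symmetric h hk X.obj Y.obj)

lemma braidingData_isUnitary {B : BraidingData k C} (hB : B.IsBraidedAntiInvolution) :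
    (braidingData B).IsUnitary := by
  intro hk X Y
  rw [isUnitary_iff_of_iso]
  change (B.beta hk X.obj Y.obj).hom ≫ ((Y.pairing.hom ⊗ₘ X.pairing.hom) ≫
    (chi Y.obj X.obj).hom) ≫ dMap (B.beta hk X.obj Y.obj).hom =
    (X.pairing.hom ⊗ₘ Y.pairing.hom) ≫ (chi X.obj Y.obj).hom
  have h2 : dMap (B.beta hk X.obj Y.obj).inv ≫ dMap (B.beta hk X.obj Y.obj).hom = 𝟙 _ := by
    rw [← dMap_comp, Iso.hom_inv_id, dMap_id]
  have h3 : (X.pairing.hom ⊗ₘ Y.pairing.hom) ≫ (B.beta hk _ _).hom =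
      (B.beta hk X.obj Y.obj).hom ≫ (Y.pairing.hom ⊗ₘ X.pairing.hom) :=
    letI := B.braiding hk
    BraidedCategory.braiding_naturality X.pairing.hom Y.pairing.hom
  rw [Category.assoc, ← reassoc_of% h3, ← reassoc_of% (hB hk X.obj Y.obj), h2, Category.comp_id]

end Herm

/-! ### The 2-category of (braided, symmetric) monoidal anti-involutive categories -/

/-- A (braided, symmetric) monoidal anti-involutive category. -/
structure AICat (k : Level) where
  carrier : Type u
  [category : Category.{v} carrier]
  [monoidal : MonoidalCategory carrier]
  [antiInvolution : MonoidalAntiInvolution carrier]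
  braiding : BraidingData k carrier
  isBraided : braiding.IsBraidedAntiInvolution

attribute [instance] AICat.category AICat.monoidal AICat.antiInvolution

namespace AICat

variable {k : Level}

/-- A (braided, symmetric) monoidal anti-involutive functor. -/
structure Hom (X Y : AICat.{v, u} k) where
  functor : X.carrier ⥤ Y.carrier
  [monoidal : functor.Monoidal]
  /-- The isomorphism with components `F (d x) ≅ d (F x)`. -/
  phi : AntiInvolution.d ⋙ functor ≅ functor.op ⋙ AntiInvolution.d
  phi_eta : ∀ x : X.carrier, functor.map (etaApp x) ≫ phi.hom.app (op (dObj x)) =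
    etaApp (functor.obj x) ≫ dMap (phi.hom.app (op x))
  phi_unit : Functor.LaxMonoidal.ε functor ≫ functor.map (uIso X.carrier).hom ≫
    phi.hom.app (op (𝟙_ X.carrier)) ≫ dMap (Functor.LaxMonoidal.ε functor) = (uIso Y.carrier).hom
  phi_tensor : ∀ x y : X.carrier,
    (phi.hom.app (op x) ⊗ₘ phi.hom.app (op y)) ≫ (chi (functor.obj x) (functor.obj y)).hom =
      Functor.LaxMonoidal.μ functor (dObj x) (dObj y) ≫ functor.map (chi x y).hom ≫
        phi.hom.app (op (x ⊗ y)) ≫ dMap (Functor.LaxMonoidal.μ functor x y)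
  isBraided : X.braiding.IsPreservedBy Y.braiding functor

attribute [instance] Hom.monoidal

namespace Hom

/-- The components `F (d x) ≅ d (F x)`. -/
abbrev phiApp {X Y : AICat.{v, u} k} (F : Hom X Y) (x : X.carrier) :
    F.functor.obj (dObj x) ≅ dObj (F.functor.obj x) :=
  F.phi.app (op x)

lemma phi_natural {X Y : AICat.{v, u} k} (F : Hom X Y) {x y : X.carrier} (f : x ⟶ y) :
    F.functor.map (dMap f) ≫ (F.phiApp x).hom = (F.phiApp y).hom ≫ dMap (F.functor.map f) :=
  F.phi.hom.naturality f.op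

lemma mk_eq {X Y : AICat.{v, u} k} {F : X.carrier ⥤ Y.carrier} {m m' : F.Monoidal}
    {φ φ' : AntiInvolution.d ⋙ F ≅ F.op ⋙ AntiInvolution.d} {a a' b b' c c' d d'}
    (hε : m.ε = m'.ε) (hμ : m.μ = m'.μ) (hφ : ∀ x, φ.hom.app x = φ'.hom.app x) :
    (@Hom.mk k X Y F m φ a b c d) = (@Hom.mk k X Y F m' φ' a' b' c' d') := by
  have h1 : m = m' := by
    apply Functor.Monoidal.toLaxMonoidal_injective
    exact Functor.LaxMonoidal.ext hε hμ
  have h2 : φ = φ' := by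
    ext x
    exact hφ x
  subst h1 h2
  rfl

/-- The identity. -/
@[simps functor]
def id (X : AICat.{v, u} k) : Hom X X where
  functor := 𝟭 _
  phi := Iso.refl _
  phi_eta x := by simp [dMap_id]
  phi_unit := by
    change 𝟙 _ ≫ (uIso X.carrier).hom ≫ 𝟙 _ ≫ dMap (𝟙 _) = _
    simp only [dMap_id, Category.id_comp, Category.comp_id]
  phi_tensor x y := by
    change (𝟙 (dObj x) ⊗ₘ 𝟙 (dObj y)) ≫ (chi x y).hom = 𝟙 _ ≫ (chi x y).hom ≫ 𝟙 _ ≫ dMap (𝟙 _)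
    simp only [dMap_id, id_tensorHom_id, Category.id_comp, Category.comp_id]
  isBraided := BraidingData.isPreservedBy_id _

/-- Composition. -/
@[simps functor]
def comp {X Y Z : AICat.{v, u} k} (F : Hom X Y) (G : Hom Y Z) : Hom X Z where
  functor := F.functor ⋙ G.functor
  phi := NatIso.ofComponents
    (fun x => G.functor.mapIso (F.phiApp x.unop) ≪≫ G.phiApp (F.functor.obj x.unop))
    (fun {x y} f => by
      have h1 := F.phi_natural f.unop
      have h2 := G.phi_natural (F.functor.map f.unop)
      change G.functor.map (F.functor.map (dMap f.unop)) ≫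
        G.functor.map (F.phiApp y.unop).hom ≫ (G.phiApp (F.functor.obj y.unop)).hom =
        (G.functor.map (F.phiApp x.unop).hom ≫ (G.phiApp (F.functor.obj x.unop)).hom) ≫
          dMap (G.functor.map (F.functor.map f.unop))
      rw [← G.functor.map_comp_assoc, h1, G.functor.map_comp_assoc, h2, Category.assoc])
  phi_eta x := by
    change G.functor.map (F.functor.map (etaApp x)) ≫ G.functor.map (F.phiApp (dObj x)).hom ≫
      (G.phiApp (F.functor.obj (dObj x))).hom = etaApp (G.functor.obj (F.functor.obj x)) ≫
        dMap (G.functor.map (F.phiApp x).hom ≫ (G.phiApp (F.functor.obj x)).hom)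
    have h1 : F.functor.map (etaApp x) ≫ (F.phiApp (dObj x)).hom =
      etaApp (F.functor.obj x) ≫ dMap (F.phiApp x).hom := F.phi_eta x
    have h2 : G.functor.map (etaApp (F.functor.obj x)) ≫ (G.phiApp (dObj (F.functor.obj x))).hom =
      etaApp (G.functor.obj (F.functor.obj x)) ≫ dMap (G.phiApp (F.functor.obj x)).hom :=
      G.phi_eta (F.functor.obj x)
    have h3 := G.phi_natural (F.phiApp x).hom
    rw [← G.functor.map_comp_assoc, h1, G.functor.map_comp_assoc, h3, reassoc_of% h2, dMap_comp]
  phi_unit := by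
    have h1 := F.phi_unit
    have h2 := G.phi_unit
    have h3 := G.phi_natural (Functor.LaxMonoidal.ε F.functor)
    change (Functor.LaxMonoidal.ε G.functor ≫ G.functor.map (Functor.LaxMonoidal.ε F.functor)) ≫
      G.functor.map (F.functor.map (uIso X.carrier).hom) ≫
      (G.functor.map (F.phiApp (𝟙_ X.carrier)).hom ≫
        (G.phiApp (F.functor.obj (𝟙_ X.carrier))).hom) ≫
      dMap (Functor.LaxMonoidal.ε G.functor ≫ G.functor.map (Functor.LaxMonoidal.ε F.functor)) = _
    change _ ≫ G.functor.map _ ≫ (G.phiApp (𝟙_ Y.carrier)).hom ≫ _ = _ at h2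
    change _ ≫ F.functor.map _ ≫ (F.phiApp (𝟙_ X.carrier)).hom ≫ _ = _ at h1
    rw [dMap_comp]
    simp only [Category.assoc]
    rw [← reassoc_of% h3]
    simp only [← Functor.map_comp_assoc]
    rw [h1, h2]
  phi_tensor x y := by
    have h1 := F.phi_tensor x y
    have h2 := G.phi_tensor (F.functor.obj x) (F.functor.obj y)
    have h3 := G.phi_natural (Functor.LaxMonoidal.μ F.functor x y)
    change ((G.functor.map (F.phiApp x).hom ≫ (G.phiApp (F.functor.obj x)).hom) ⊗ₘ
      (G.functor.map (F.phiApp y).hom ≫ (G.phiApp (F.functor.obj y)).hom)) ≫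
      (chi (G.functor.obj (F.functor.obj x)) (G.functor.obj (F.functor.obj y))).hom =
      (Functor.LaxMonoidal.μ G.functor (F.functor.obj (dObj x)) (F.functor.obj (dObj y)) ≫
        G.functor.map (Functor.LaxMonoidal.μ F.functor (dObj x) (dObj y))) ≫
      G.functor.map (F.functor.map (chi x y).hom) ≫
      (G.functor.map (F.phiApp (x ⊗ y)).hom ≫ (G.phiApp (F.functor.obj (x ⊗ y))).hom) ≫
      dMap (Functor.LaxMonoidal.μ G.functor (F.functor.obj x) (F.functor.obj y) ≫
        G.functor.map (Functor.LaxMonoidal.μ F.functor x y))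
    change ((G.phiApp (F.functor.obj x)).hom ⊗ₘ (G.phiApp (F.functor.obj y)).hom) ≫ _ =
      _ ≫ G.functor.map _ ≫ (G.phiApp (F.functor.obj x ⊗ F.functor.obj y)).hom ≫ _ at h2
    change ((F.phiApp x).hom ⊗ₘ (F.phiApp y).hom) ≫ _ =
      _ ≫ F.functor.map _ ≫ (F.phiApp (x ⊗ y)).hom ≫ _ at h1
    rw [dMap_comp, ← tensorHom_comp_tensorHom, Category.assoc, h2]
    simp only [Category.assoc]
    rw [← reassoc_of% h3]
    simp only [← Functor.map_comp_assoc]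
    rw [← h1, Functor.map_comp_assoc, Functor.LaxMonoidal.μ_natural_assoc]
  isBraided := BraidingData.isPreservedBy_comp F.isBraided G.isBraided

end Hom

/-- A (braided, symmetric) monoidal anti-involutive natural transformation. -/
structure Hom₂ {X Y : AICat.{v, u} k} (F G : Hom X Y) where
  toNatTrans : F.functor ⟶ G.functor
  isMonoidal : NatTrans.IsMonoidal toNatTrans
  antiInvolutive : ∀ x : X.carrier, (F.phiApp x).hom =
    toNatTrans.app (dObj x) ≫ (G.phiApp x).hom ≫ dMap (toNatTrans.app x)

instance : CategoryStruct (AICat.{v, u} k) where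
  Hom := Hom
  id := Hom.id
  comp := Hom.comp

@[simp] lemma id_functor (X : AICat.{v, u} k) : Hom.functor (𝟙 X) = 𝟭 X.carrier := rfl

@[simp] lemma comp_functor {X Y Z : AICat.{v, u} k} (F : X ⟶ Y) (G : Y ⟶ Z) :
    (F ≫ G).functor = F.functor ⋙ G.functor := rfl

lemma comp_phiApp {X Y Z : AICat.{v, u} k} (F : X ⟶ Y) (G : Y ⟶ Z) (x : X.carrier) :
    (Hom.phiApp (F ≫ G) x).hom =
      G.functor.map (F.phiApp x).hom ≫ (G.phiApp (F.functor.obj x)).hom := rfl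

@[simp] lemma id_phi_app (X : AICat.{v, u} k) (x : X.carrier) :
    (Hom.phi (𝟙 X)).hom.app (op x) = 𝟙 (dObj x) := rfl

@[simp] lemma comp_phi_app {X Y Z : AICat.{v, u} k} (F : X ⟶ Y) (G : Y ⟶ Z) (x : X.carrier) :
    (Hom.phi (F ≫ G)).hom.app (op x) =
      G.functor.map (F.phi.hom.app (op x)) ≫ G.phi.hom.app (op (F.functor.obj x)) := rfl

instance homCategory (X Y : AICat.{v, u} k) : Category (X ⟶ Y) where
  Hom F G := Hom₂ F G
  id F :=
    { toNatTrans := 𝟙 F.functor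
      isMonoidal := inferInstance
      antiInvolutive := fun x => by simp [dMap_id] }
  comp {F G H} σ τ :=
    { toNatTrans := σ.toNatTrans ≫ τ.toNatTrans
      isMonoidal := by
        have := σ.isMonoidal
        have := τ.isMonoidal
        infer_instance
      antiInvolutive := fun x => by
        rw [NatTrans.comp_app, NatTrans.comp_app, dMap_comp, σ.antiInvolutive, τ.antiInvolutive]
        simp only [Category.assoc] }
  id_comp _ := by congr 1; exact Category.id_comp _
  comp_id _ := by congr 1; exact Category.comp_id _
  assoc _ _ _ := by congr 1; exact Category.assoc _ _ _

lemma hom₂_ext {X Y : AICat.{v, u} k} {F G : X ⟶ Y} {σ τ : F ⟶ G}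
    (h : ∀ x, σ.toNatTrans.app x = τ.toNatTrans.app x) : σ = τ := by
  obtain ⟨s, hs, hs'⟩ := σ
  obtain ⟨t, ht, ht'⟩ := τ
  obtain rfl : s = t := NatTrans.ext (funext h)
  rfl

@[simp] lemma id_app {X Y : AICat.{v, u} k} (F : X ⟶ Y) (x : X.carrier) :
    (Hom₂.toNatTrans (𝟙 F)).app x = 𝟙 (F.functor.obj x) := rfl

@[simp] lemma comp_app {X Y : AICat.{v, u} k} {F G H : X ⟶ Y} (σ : F ⟶ G) (τ : G ⟶ H)
    (x : X.carrier) :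
    (σ ≫ τ).toNatTrans.app x = σ.toNatTrans.app x ≫ τ.toNatTrans.app x := rfl

/-- An invertible 2-morphism between 1-morphisms with the same underlying functor, all of whose
components are identities. -/
def isoOfId {X Y : AICat.{v, u} k} (F G : X ⟶ Y) (e : F.functor ≅ G.functor)
    (h₁ : NatTrans.IsMonoidal e.hom) (h₂ : ∀ x : X.carrier, (F.phiApp x).hom =
    e.hom.app (dObj x) ≫ (G.phiApp x).hom ≫ dMap (e.hom.app x)) : F ≅ G where
  hom := ⟨e.hom, h₁, h₂⟩
  inv := ⟨e.inv, inferInstance, fun x => by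
    have h3 : dMap (e.hom.app x) ≫ dMap (e.inv.app x) = 𝟙 _ := by
      rw [← dMap_comp, Iso.inv_hom_id_app, dMap_id]
    rw [h₂ x]
    simp [h3]⟩
  hom_inv_id := hom₂_ext fun x => e.hom_inv_id_app x
  inv_hom_id := hom₂_ext fun x => e.inv_hom_id_app x

instance bicategory : Bicategory (AICat.{v, u} k) where
  homCategory := homCategory
  whiskerLeft {X Y Z} F {G H} τ :=
    { toNatTrans := Functor.whiskerLeft F.functor τ.toNatTrans
      isMonoidal := by
        have := τ.isMonoidal
        change NatTrans.IsMonoidal (Functor.whiskerLeft F.functor τ.toNatTrans)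
        infer_instance
      antiInvolutive := fun x => by
        rw [comp_phiApp, comp_phiApp, τ.antiInvolutive]
        simp }
  whiskerRight {X Y Z} {F G} τ H :=
    { toNatTrans := Functor.whiskerRight τ.toNatTrans H.functor
      isMonoidal := by
        have := τ.isMonoidal
        change NatTrans.IsMonoidal (Functor.whiskerRight τ.toNatTrans H.functor)
        infer_instance
      antiInvolutive := fun x => by
        have h := H.phi_natural (τ.toNatTrans.app x)
        change H.functor.map (F.phiApp x).hom ≫ (H.phiApp (F.functor.obj x)).hom =
          H.functor.map (τ.toNatTrans.app (dObj x)) ≫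
          (H.functor.map (G.phiApp x).hom ≫ (H.phiApp (G.functor.obj x)).hom) ≫
          dMap (H.functor.map (τ.toNatTrans.app x))
        rw [τ.antiInvolutive]
        simp only [Functor.map_comp, Category.assoc]
        rw [h] }
  associator F G H := isoOfId _ _ (Functor.associator F.functor G.functor H.functor)
    (inferInstanceAs (NatTrans.IsMonoidal
      (Functor.associator F.functor G.functor H.functor).hom)) (fun x => by
      simp [dMap_id])
  leftUnitor F := isoOfId _ _ (Functor.leftUnitor F.functor)
    (inferInstanceAs (NatTrans.IsMonoidal (Functor.leftUnitor F.functor).hom)) (fun x => by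
      simp [dMap_id])
  rightUnitor F := isoOfId _ _ (Functor.rightUnitor F.functor)
    (inferInstanceAs (NatTrans.IsMonoidal (Functor.rightUnitor F.functor).hom)) (fun x => by
      simp [dMap_id])
  whiskerLeft_id _ _ := hom₂_ext fun x => by simp
  whiskerLeft_comp _ _ _ _ _ _ := hom₂_ext fun x => by simp
  id_whiskerLeft _ := hom₂_ext fun x => ((Category.id_comp _).trans (Category.comp_id _)).symm
  comp_whiskerLeft _ _ _ _ _ := hom₂_ext fun x => ((Category.id_comp _).trans (Category.comp_id _)).symm
  id_whiskerRight _ _ := hom₂_ext fun x => by simp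
  comp_whiskerRight _ _ _ := hom₂_ext fun x => by simp
  whiskerRight_id _ := hom₂_ext fun x => ((Category.id_comp _).trans (Category.comp_id _)).symm
  whiskerRight_comp _ _ _ := hom₂_ext fun x => ((Category.id_comp _).trans (Category.comp_id _)).symm
  whisker_assoc _ _ _ _ _ := hom₂_ext fun x => ((Category.id_comp _).trans (Category.comp_id _)).symm
  whisker_exchange _ _ := hom₂_ext fun x => by simp
  pentagon _ _ _ K := hom₂_ext fun x => by
    change K.functor.map (𝟙 _) ≫ 𝟙 _ ≫ 𝟙 _ = 𝟙 _ ≫ 𝟙 _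
    simp
  triangle _ G := hom₂_ext fun x => by
    change 𝟙 _ ≫ 𝟙 _ = G.functor.map (𝟙 _)
    simp

lemma eqToIso_app {X Y : AICat.{v, u} k} {F G : X ⟶ Y} (h : F = G) (x : X.carrier) :
    (Hom₂.toNatTrans (eqToIso h).hom).app x =
      eqToHom (congrArg (fun K : Hom X Y => K.functor.obj x) h) := by
  subst h
  rfl

lemma eqToHom_app {X Y : AICat.{v, u} k} {F G : X ⟶ Y} (h : F = G) (x : X.carrier) :
    (Hom₂.toNatTrans (eqToHom h)).app x =
      eqToHom (congrArg (fun K : Hom X Y => K.functor.obj x) h) := by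
  subst h
  rfl

open Functor.LaxMonoidal in
lemma id_comp' {X Y : AICat.{v, u} k} (F : X ⟶ Y) : 𝟙 X ≫ F = F := Hom.mk_eq
    (by change ε F.functor ≫ F.functor.map (𝟙 _) = ε F.functor; simp)
    (by ext x y; change μ F.functor x y ≫ F.functor.map (𝟙 _) = μ F.functor x y; simp)
    (fun x => by change F.functor.map (𝟙 _) ≫ F.phi.hom.app x = F.phi.hom.app x; simp)

open Functor.LaxMonoidal in
lemma comp_id' {X Y : AICat.{v, u} k} (F : X ⟶ Y) : F ≫ 𝟙 Y = F := Hom.mk_eq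
    (by change 𝟙 _ ≫ ε F.functor = ε F.functor; simp)
    (by ext x y; change 𝟙 _ ≫ μ F.functor x y = μ F.functor x y; simp)
    (fun x => by change F.phi.hom.app x ≫ 𝟙 _ = F.phi.hom.app x; simp)

open Functor.LaxMonoidal in
lemma assoc' {W X Y Z : AICat.{v, u} k} (F : W ⟶ X) (G : X ⟶ Y) (H : Y ⟶ Z) :
    (F ≫ G) ≫ H = F ≫ G ≫ H := Hom.mk_eq
    (by
      change ε H.functor ≫ H.functor.map (ε G.functor ≫ G.functor.map (ε F.functor)) =
        (ε H.functor ≫ H.functor.map (ε G.functor)) ≫ H.functor.map (G.functor.map (ε F.functor))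
      simp)
    (by
      ext x y
      change μ H.functor _ _ ≫ H.functor.map (μ G.functor _ _ ≫ G.functor.map (μ F.functor x y)) =
        (μ H.functor _ _ ≫ H.functor.map (μ G.functor _ _)) ≫
          H.functor.map (G.functor.map (μ F.functor x y))
      simp)
    (fun x => by
      change H.functor.map (G.functor.map (F.phi.hom.app x) ≫ G.phi.hom.app _) ≫ H.phi.hom.app _ =
        H.functor.map (G.functor.map (F.phi.hom.app x)) ≫
          H.functor.map (G.phi.hom.app _) ≫ H.phi.hom.app _
      simp)

instance strict : Bicategory.Strict (AICat.{v, u} k) where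
  id_comp := id_comp'
  comp_id := comp_id'
  assoc := assoc'
  leftUnitor_eqToIso F := Iso.ext (hom₂_ext fun x => (eqToIso_app (id_comp' F) x).symm)
  rightUnitor_eqToIso F := Iso.ext (hom₂_ext fun x => (eqToIso_app (comp_id' F) x).symm)
  associator_eqToIso F G H := Iso.ext (hom₂_ext fun x => (eqToIso_app (assoc' F G H) x).symm)

end AICat

/-! ### The 2-category of (braided, symmetric) monoidal dagger categories -/

lemma IsUnitary.id {C : Type u} [Category.{v} C] [DaggerCategory C] (X : C) :
    IsUnitary (𝟙 X) := by
  simp [IsUnitary, dag_id]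

lemma IsUnitary.comp {C : Type u} [Category.{v} C] [DaggerCategory C] {X Y Z : C} {f : X ⟶ Y}
    {g : Y ⟶ Z} (hf : IsUnitary f) (hg : IsUnitary g) : IsUnitary (f ≫ g) := by
  obtain ⟨hf₁, hf₂⟩ := hf
  obtain ⟨hg₁, hg₂⟩ := hg
  constructor
  · rw [dag_comp, Category.assoc, reassoc_of% hg₁, hf₁]
  · rw [dag_comp, Category.assoc, reassoc_of% hf₂, hg₂]

/-- A (braided, symmetric) monoidal dagger category. -/
structure DagCat (k : Level) where
  carrier : Type u
  [category : Category.{v} carrier]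
  [monoidal : MonoidalCategory carrier]
  [dagger : DaggerCategory carrier]
  [monoidalDagger : MonoidalDagger carrier]
  braiding : BraidingData k carrier
  isUnitary : braiding.IsUnitary

attribute [instance] DagCat.category DagCat.monoidal DagCat.dagger DagCat.monoidalDagger

namespace DagCat

variable {k : Level}

/-- A (braided, symmetric) monoidal dagger functor. -/
structure Hom (X Y : DagCat.{v, u} k) where
  functor : X.carrier ⥤ Y.carrier
  [monoidal : functor.Monoidal]
  map_dag : ∀ {x y : X.carrier} (f : x ⟶ y), functor.map (dag f) = dag (functor.map f)
  unitary_unit : IsUnitary (Functor.LaxMonoidal.ε functor)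
  unitary_tensor : ∀ x y : X.carrier, IsUnitary (Functor.LaxMonoidal.μ functor x y)
  isBraided : X.braiding.IsPreservedBy Y.braiding functor

attribute [instance] Hom.monoidal

namespace Hom

lemma map_isUnitary {X Y : DagCat.{v, u} k} (F : Hom X Y) {x y : X.carrier} {f : x ⟶ y}
    (hf : IsUnitary f) : IsUnitary (F.functor.map f) := by
  obtain ⟨h₁, h₂⟩ := hf
  constructor
  · rw [← F.map_dag, ← F.functor.map_comp, h₁, F.functor.map_id]
  · rw [← F.map_dag, ← F.functor.map_comp, h₂, F.functor.map_id]

lemma mk_eq {X Y : DagCat.{v, u} k} {F : X.carrier ⥤ Y.carrier} {m m' : F.Monoidal}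
    {a a' b b' c c' d d'} (hε : m.ε = m'.ε) (hμ : m.μ = m'.μ) :
    (@Hom.mk k X Y F m a b c d) = (@Hom.mk k X Y F m' a' b' c' d') := by
  have h1 : m = m' := by
    apply Functor.Monoidal.toLaxMonoidal_injective
    exact Functor.LaxMonoidal.ext hε hμ
  subst h1
  rfl

/-- The identity. -/
@[simps functor]
def id (X : DagCat.{v, u} k) : Hom X X where
  functor := 𝟭 _
  map_dag _ := rfl
  unitary_unit := IsUnitary.id _
  unitary_tensor _ _ := IsUnitary.id _
  isBraided := BraidingData.isPreservedBy_id _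

/-- Composition. -/
@[simps functor]
def comp {X Y Z : DagCat.{v, u} k} (F : Hom X Y) (G : Hom Y Z) : Hom X Z where
  functor := F.functor ⋙ G.functor
  map_dag f := by rw [Functor.comp_map, F.map_dag, G.map_dag, Functor.comp_map]
  unitary_unit := IsUnitary.comp G.unitary_unit (G.map_isUnitary F.unitary_unit)
  unitary_tensor x y :=
    IsUnitary.comp (G.unitary_tensor _ _) (G.map_isUnitary (F.unitary_tensor x y))
  isBraided := BraidingData.isPreservedBy_comp F.isBraided G.isBraided

end Hom

/-- A (braided, symmetric) monoidal isometric natural transformation. -/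
structure Hom₂ {X Y : DagCat.{v, u} k} (F G : Hom X Y) where
  toNatTrans : F.functor ⟶ G.functor
  isMonoidal : NatTrans.IsMonoidal toNatTrans
  isometric : ∀ x : X.carrier, IsIsometry (toNatTrans.app x)

instance : CategoryStruct (DagCat.{v, u} k) where
  Hom := Hom
  id := Hom.id
  comp := Hom.comp

@[simp] lemma id_functor (X : DagCat.{v, u} k) : Hom.functor (𝟙 X) = 𝟭 X.carrier := rfl

@[simp] lemma comp_functor {X Y Z : DagCat.{v, u} k} (F : X ⟶ Y) (G : Y ⟶ Z) :
    (F ≫ G).functor = F.functor ⋙ G.functor := rfl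

instance homCategory (X Y : DagCat.{v, u} k) : Category (X ⟶ Y) where
  Hom F G := Hom₂ F G
  id F :=
    { toNatTrans := 𝟙 F.functor
      isMonoidal := inferInstance
      isometric := fun x => (IsUnitary.id _).1 }
  comp {F G H} σ τ :=
    { toNatTrans := σ.toNatTrans ≫ τ.toNatTrans
      isMonoidal := by
        have := σ.isMonoidal
        have := τ.isMonoidal
        infer_instance
      isometric := fun x => by
        have h1 := σ.isometric x
        have h2 := τ.isometric x
        unfold IsIsometry at *
        rw [NatTrans.comp_app, dag_comp, Category.assoc, reassoc_of% h2, h1] }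
  id_comp _ := by congr 1; exact Category.id_comp _
  comp_id _ := by congr 1; exact Category.comp_id _
  assoc _ _ _ := by congr 1; exact Category.assoc _ _ _

lemma hom₂_ext {X Y : DagCat.{v, u} k} {F G : X ⟶ Y} {σ τ : F ⟶ G}
    (h : ∀ x, σ.toNatTrans.app x = τ.toNatTrans.app x) : σ = τ := by
  obtain ⟨s, hs, hs'⟩ := σ
  obtain ⟨t, ht, ht'⟩ := τ
  obtain rfl : s = t := NatTrans.ext (funext h)
  rfl

@[simp] lemma id_app {X Y : DagCat.{v, u} k} (F : X ⟶ Y) (x : X.carrier) :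
    (Hom₂.toNatTrans (𝟙 F)).app x = 𝟙 (F.functor.obj x) := rfl

@[simp] lemma comp_app {X Y : DagCat.{v, u} k} {F G H : X ⟶ Y} (σ : F ⟶ G) (τ : G ⟶ H)
    (x : X.carrier) :
    (σ ≫ τ).toNatTrans.app x = σ.toNatTrans.app x ≫ τ.toNatTrans.app x := rfl

/-- An invertible 2-morphism from a monoidal natural isomorphism with isometric components. -/
def isoMk {X Y : DagCat.{v, u} k} (F G : X ⟶ Y) (e : F.functor ≅ G.functor)
    (h₁ : NatTrans.IsMonoidal e.hom) (h₂ : ∀ x : X.carrier, IsIsometry (e.hom.app x)) :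
    F ≅ G where
  hom := ⟨e.hom, h₁, h₂⟩
  inv := ⟨e.inv, inferInstance, fun x => by
    have h3 : e.inv.app x = dag (e.hom.app x) := by
      have := h₂ x
      unfold IsIsometry at this
      rw [← cancel_epi (e.hom.app x), this, Iso.hom_inv_id_app]
    unfold IsIsometry
    rw [h3, dag_dag, ← h3, Iso.inv_hom_id_app]⟩
  hom_inv_id := hom₂_ext fun x => e.hom_inv_id_app x
  inv_hom_id := hom₂_ext fun x => e.inv_hom_id_app x

instance bicategory : Bicategory (DagCat.{v, u} k) where
  homCategory := homCategory
  whiskerLeft {X Y Z} F {G H} τ :=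
    { toNatTrans := Functor.whiskerLeft F.functor τ.toNatTrans
      isMonoidal := by
        have := τ.isMonoidal
        change NatTrans.IsMonoidal (Functor.whiskerLeft F.functor τ.toNatTrans)
        infer_instance
      isometric := fun x => τ.isometric (F.functor.obj x) }
  whiskerRight {X Y Z} {F G} τ H :=
    { toNatTrans := Functor.whiskerRight τ.toNatTrans H.functor
      isMonoidal := by
        have := τ.isMonoidal
        change NatTrans.IsMonoidal (Functor.whiskerRight τ.toNatTrans H.functor)
        infer_instance
      isometric := fun x => by
        have h : τ.toNatTrans.app x ≫ dag (τ.toNatTrans.app x) = 𝟙 _ := τ.isometric x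
        change H.functor.map (τ.toNatTrans.app x) ≫ dag (H.functor.map (τ.toNatTrans.app x)) = 𝟙 _
        rw [← H.map_dag, ← H.functor.map_comp, h, H.functor.map_id] }
  associator F G H := isoMk _ _ (Functor.associator F.functor G.functor H.functor)
    (inferInstanceAs (NatTrans.IsMonoidal
      (Functor.associator F.functor G.functor H.functor).hom)) (fun x => (IsUnitary.id _).1)
  leftUnitor F := isoMk _ _ (Functor.leftUnitor F.functor)
    (inferInstanceAs (NatTrans.IsMonoidal (Functor.leftUnitor F.functor).hom))
    (fun x => (IsUnitary.id _).1)
  rightUnitor F := isoMk _ _ (Functor.rightUnitor F.functor)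
    (inferInstanceAs (NatTrans.IsMonoidal (Functor.rightUnitor F.functor).hom))
    (fun x => (IsUnitary.id _).1)
  whiskerLeft_id _ _ := hom₂_ext fun x => by simp
  whiskerLeft_comp _ _ _ _ _ _ := hom₂_ext fun x => by simp
  id_whiskerLeft _ := hom₂_ext fun x =>
    ((Category.id_comp _).trans (Category.comp_id _)).symm
  comp_whiskerLeft _ _ _ _ _ := hom₂_ext fun x =>
    ((Category.id_comp _).trans (Category.comp_id _)).symm
  id_whiskerRight _ _ := hom₂_ext fun x => by simp
  comp_whiskerRight _ _ _ := hom₂_ext fun x => by simp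
  whiskerRight_id _ := hom₂_ext fun x =>
    ((Category.id_comp _).trans (Category.comp_id _)).symm
  whiskerRight_comp _ _ _ := hom₂_ext fun x =>
    ((Category.id_comp _).trans (Category.comp_id _)).symm
  whisker_assoc _ _ _ _ _ := hom₂_ext fun x =>
    ((Category.id_comp _).trans (Category.comp_id _)).symm
  whisker_exchange _ _ := hom₂_ext fun x => by simp
  pentagon _ _ _ K := hom₂_ext fun x => by
    change K.functor.map (𝟙 _) ≫ 𝟙 _ ≫ 𝟙 _ = 𝟙 _ ≫ 𝟙 _
    simp
  triangle _ G := hom₂_ext fun x => by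
    change 𝟙 _ ≫ 𝟙 _ = G.functor.map (𝟙 _)
    simp

lemma eqToIso_app {X Y : DagCat.{v, u} k} {F G : X ⟶ Y} (h : F = G) (x : X.carrier) :
    (Hom₂.toNatTrans (eqToIso h).hom).app x =
      eqToHom (congrArg (fun K : Hom X Y => K.functor.obj x) h) := by
  subst h
  rfl

open Functor.LaxMonoidal in
lemma id_comp' {X Y : DagCat.{v, u} k} (F : X ⟶ Y) : 𝟙 X ≫ F = F := Hom.mk_eq
  (by change ε F.functor ≫ F.functor.map (𝟙 _) = ε F.functor; simp)
  (by ext x y; change μ F.functor x y ≫ F.functor.map (𝟙 _) = μ F.functor x y; simp)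

open Functor.LaxMonoidal in
lemma comp_id' {X Y : DagCat.{v, u} k} (F : X ⟶ Y) : F ≫ 𝟙 Y = F := Hom.mk_eq
  (by change 𝟙 _ ≫ ε F.functor = ε F.functor; simp)
  (by ext x y; change 𝟙 _ ≫ μ F.functor x y = μ F.functor x y; simp)

open Functor.LaxMonoidal in
lemma assoc' {W X Y Z : DagCat.{v, u} k} (F : W ⟶ X) (G : X ⟶ Y) (H : Y ⟶ Z) :
    (F ≫ G) ≫ H = F ≫ G ≫ H := Hom.mk_eq
  (by
    change ε H.functor ≫ H.functor.map (ε G.functor ≫ G.functor.map (ε F.functor)) =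
      (ε H.functor ≫ H.functor.map (ε G.functor)) ≫ H.functor.map (G.functor.map (ε F.functor))
    simp)
  (by
    ext x y
    change μ H.functor _ _ ≫ H.functor.map (μ G.functor _ _ ≫ G.functor.map (μ F.functor x y)) =
      (μ H.functor _ _ ≫ H.functor.map (μ G.functor _ _)) ≫
        H.functor.map (G.functor.map (μ F.functor x y))
    simp)

instance strict : Bicategory.Strict (DagCat.{v, u} k) where
  id_comp := id_comp'
  comp_id := comp_id'
  assoc := assoc'
  leftUnitor_eqToIso F := Iso.ext (hom₂_ext fun x => (eqToIso_app (id_comp' F) x).symm)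
  rightUnitor_eqToIso F := Iso.ext (hom₂_ext fun x => (eqToIso_app (comp_id' F) x).symm)
  associator_eqToIso F G H := Iso.ext (hom₂_ext fun x => (eqToIso_app (assoc' F G H) x).symm)

end DagCat

/-! ### The canonical 2-functor from dagger categories to anti-involutive categories -/

section

variable (C : Type u) [Category.{v} C] [DaggerCategory C]

/-- A dagger, as a functor `Cᵒᵖ ⥤ C`. -/
@[simps]
def dagFunctor : Cᵒᵖ ⥤ C where
  obj X := X.unop
  map f := dag f.unop
  map_id X := dag_id X.unop
  map_comp f g := dag_comp g.unop f.unop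

/-- A dagger category regarded as an anti-involutive category with `d = †` and `η = id`. -/
abbrev dagAntiInvolution : AntiInvolution C where
  d := dagFunctor C
  eta := NatIso.ofComponents (fun X => Iso.refl X) (fun {X Y} f => by
    change f ≫ 𝟙 Y = 𝟙 X ≫ dag (dag f)
    rw [dag_dag, Category.comp_id, Category.id_comp])
  eta_d c := by
    change 𝟙 c ≫ dag (𝟙 c) = 𝟙 c
    rw [dag_id, Category.comp_id]

lemma isUnitary_iff_dag_eq_inv {C : Type u} [Category.{v} C] [DaggerCategory C] {X Y : C}
    (e : X ≅ Y) : IsUnitary e.hom ↔ dag e.hom = e.inv := by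
  constructor
  · intro h
    rw [← cancel_epi e.hom, h.1, Iso.hom_inv_id]
  · intro h
    constructor
    · rw [h, Iso.hom_inv_id]
    · rw [h, Iso.inv_hom_id]

variable [MonoidalCategory C] [MonoidalDagger C]

/-- The identity monoidal structure on the dagger functor. -/
instance dagFunctorMonoidal : (dagFunctor C).Monoidal :=
  Functor.CoreMonoidal.toMonoidal
    { εIso := Iso.refl (𝟙_ C)
      μIso := fun X Y => Iso.refl (X.unop ⊗ Y.unop)
      μIso_hom_natural_left := fun {X Y} f Z => by
        change (dag f.unop ▷ Z.unop) ≫ 𝟙 _ = 𝟙 _ ≫ dag (f.unop ▷ Z.unop)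
        rw [← tensorHom_id, ← tensorHom_id, MonoidalDagger.dag_tensorHom, dag_id,
          Category.id_comp, Category.comp_id]
      μIso_hom_natural_right := fun {X Y} Z f => by
        change (Z.unop ◁ dag f.unop) ≫ 𝟙 _ = 𝟙 _ ≫ dag (Z.unop ◁ f.unop)
        rw [← id_tensorHom, ← id_tensorHom, MonoidalDagger.dag_tensorHom, dag_id,
          Category.id_comp, Category.comp_id]
      associativity := fun X Y Z => by
        change (𝟙 _ ▷ Z.unop) ≫ 𝟙 _ ≫ dag (α_ X.unop Y.unop Z.unop).inv =
          (α_ X.unop Y.unop Z.unop).hom ≫ (X.unop ◁ 𝟙 _) ≫ 𝟙 _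
        have h := (isUnitary_iff_dag_eq_inv _).1
          (MonoidalDagger.unitary_associator X.unop Y.unop Z.unop)
        rw [← h, dag_dag]
        simp
      left_unitality := fun X => by
        change (λ_ X.unop).hom = (𝟙 _ ▷ X.unop) ≫ 𝟙 _ ≫ dag (λ_ X.unop).inv
        have h := (isUnitary_iff_dag_eq_inv _).1 (MonoidalDagger.unitary_leftUnitor X.unop)
        rw [← h, dag_dag]
        simp
      right_unitality := fun X => by
        change (ρ_ X.unop).hom = (X.unop ◁ 𝟙 _) ≫ 𝟙 _ ≫ dag (ρ_ X.unop).inv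
        have h := (isUnitary_iff_dag_eq_inv _).1 (MonoidalDagger.unitary_rightUnitor X.unop)
        rw [← h, dag_dag]
        simp }

/-- A monoidal dagger category regarded as a monoidal anti-involutive category with trivial
coherence data `η`, `χ` and `u`. -/
abbrev dagMonoidalAntiInvolution : MonoidalAntiInvolution C where
  toAntiInvolution := dagAntiInvolution C
  monoidal := dagFunctorMonoidal C
  eta_unit := by
    change 𝟙 _ ≫ dag (𝟙 _) = 𝟙 _
    rw [dag_id, Category.comp_id]
  eta_tensor X Y := by
    change 𝟙 _ ≫ dag (𝟙 _) = (𝟙 X ⊗ₘ 𝟙 Y) ≫ 𝟙 _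
    rw [dag_id, Category.comp_id, Category.comp_id, id_tensorHom_id]

end

/-- The canonical 2-functor on objects. -/
def canonicalObj {k : Level} (D : DagCat.{v, u} k) : AICat.{v, u} k :=
  letI := dagMonoidalAntiInvolution D.carrier
  { carrier := D.carrier
    braiding := D.braiding
    isBraided := fun hk X Y => by
      change 𝟙 _ ≫ dag (D.braiding.beta hk X Y).inv = (D.braiding.beta hk X Y).hom ≫ 𝟙 _
      have h := (isUnitary_iff_dag_eq_inv _).1 (D.isUnitary hk X Y)
      rw [← h, dag_dag, Category.id_comp, Category.comp_id] }

/-- The canonical 2-functor on 1-morphisms: the comparison isomorphism `φ` is the identity. -/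
def canonicalMap {k : Level} {D E : DagCat.{v, u} k} (F : D ⟶ E) :
    canonicalObj D ⟶ canonicalObj E :=
  { functor := F.functor
    monoidal := F.monoidal
    phi := NatIso.ofComponents (fun X => Iso.refl (F.functor.obj X.unop)) (fun f =>
      (Category.comp_id _).trans ((F.map_dag f.unop).trans (Category.id_comp _).symm))
    phi_eta := fun x =>
      ((Category.comp_id _).trans (F.functor.map_id x)).trans
        ((Category.id_comp _).trans (dag_id _)).symm
    phi_unit := by
      change Functor.LaxMonoidal.ε F.functor ≫ F.functor.map (𝟙 _) ≫ 𝟙 _ ≫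
        dag (Functor.LaxMonoidal.ε F.functor) = 𝟙 _
      rw [F.functor.map_id, Category.id_comp, Category.id_comp, F.unitary_unit.1]
    phi_tensor := fun x y => by
      change (𝟙 _ ⊗ₘ 𝟙 _) ≫ 𝟙 _ = Functor.LaxMonoidal.μ F.functor x y ≫ F.functor.map (𝟙 _) ≫ 𝟙 _ ≫
        dag (Functor.LaxMonoidal.μ F.functor x y)
      rw [F.functor.map_id, Category.id_comp, Category.id_comp, (F.unitary_tensor x y).1,
        id_tensorHom_id, Category.id_comp]
    isBraided := F.isBraided }

/-- The canonical 2-functor on 2-morphisms. -/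
def canonicalMap₂ {k : Level} {D E : DagCat.{v, u} k} {F G : D ⟶ E} (τ : F ⟶ G) :
    canonicalMap F ⟶ canonicalMap G :=
  { toNatTrans := τ.toNatTrans
    isMonoidal := τ.isMonoidal
    antiInvolutive := fun x => by
      have h : τ.toNatTrans.app x ≫ dag (τ.toNatTrans.app x) = 𝟙 _ := τ.isometric x
      change 𝟙 _ = τ.toNatTrans.app x ≫ 𝟙 _ ≫ dag (τ.toNatTrans.app x)
      rw [Category.id_comp, h] }

lemma canonical_map_comp {k : Level} {D E E' : DagCat.{v, u} k} (F : D ⟶ E) (G : E ⟶ E') :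
    canonicalMap (F ≫ G) = canonicalMap F ≫ canonicalMap G :=
  AICat.Hom.mk_eq rfl rfl (fun x =>
    ((Category.comp_id _).trans (G.functor.map_id (F.functor.obj x.unop))).symm)

lemma whisker_aux {C : Type u} [Category.{v} C] {X Y : C} {f : X ⟶ X} {g : Y ⟶ Y} (hf : f = 𝟙 X)
    (hg : g = 𝟙 Y) (h : X ⟶ Y) : h = f ≫ h ≫ g := by
  rw [hf, hg, Category.id_comp, Category.comp_id]

/-- The canonical 2-functor from (braided, symmetric) monoidal dagger categories to (braided,
symmetric) monoidal anti-involutive categories. -/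
def canonical (k : Level) : StrictPseudofunctor (DagCat.{v, u} k) (AICat.{v, u} k) :=
  StrictPseudofunctor.mk''
    { obj := canonicalObj
      map := canonicalMap
      map₂ := canonicalMap₂
      map₂_id := fun _ => rfl
      map₂_comp := fun _ _ => rfl
      map_id := fun X => AICat.Hom.mk_eq rfl rfl (fun x => rfl)
      map_comp := canonical_map_comp
      map₂_whisker_left := fun {_ _ _} F {G H} τ => AICat.hom₂_ext fun x =>
        (whisker_aux (AICat.eqToHom_app (canonical_map_comp F G) x)
          (AICat.eqToHom_app (canonical_map_comp F H).symm x) (τ.toNatTrans.app (F.functor.obj x)))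
      map₂_whisker_right := fun {_ _ _ F G} τ H => AICat.hom₂_ext fun x =>
        (whisker_aux (AICat.eqToHom_app (canonical_map_comp F H) x)
          (AICat.eqToHom_app (canonical_map_comp G H).symm x)
          (H.functor.map (τ.toNatTrans.app x))) }

/-! ### The Hermitian completion on objects, 1-morphisms and 2-morphisms -/

/-- The Hermitian completion of a (braided, symmetric) monoidal anti-involutive category, with its
structure of a (braided, symmetric) monoidal dagger category. -/
def hermObj {k : Level} (X : AICat.{v, u} k) : DagCat.{v, max u v} k where
  carrier := Herm X.carrier
  braiding := Herm.braidingData X.braiding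
  isUnitary := Herm.braidingData_isUnitary X.isBraided

section

variable {k : Level} {X Y : AICat.{v, u} k} (F : AICat.Hom X Y)

/-- The Hermitian pairing `φ ∘ F h` on `F c` induced by a Hermitian pairing `h` on `c`. -/
@[simps]
def hermFunctorObj (x : Herm X.carrier) : Herm Y.carrier where
  obj := F.functor.obj x.obj
  pairing := F.functor.mapIso x.pairing ≪≫ F.phiApp x.obj
  hermitian := by
    change etaApp (F.functor.obj x.obj) ≫
      dMap (F.functor.map x.pairing.hom ≫ (F.phiApp x.obj).hom) =
      F.functor.map x.pairing.hom ≫ (F.phiApp x.obj).hom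
    have h1 : F.functor.map (etaApp x.obj) ≫ (F.phiApp (dObj x.obj)).hom =
      etaApp (F.functor.obj x.obj) ≫ dMap (F.phiApp x.obj).hom := F.phi_eta x.obj
    have h2 := F.phi_natural x.pairing.hom
    rw [dMap_comp, ← reassoc_of% h1, ← h2, ← F.functor.map_comp_assoc, x.pairing_dMap]

/-- The functor between Hermitian completions induced by an anti-involutive functor. -/
@[simps]
def hermFunctor : Herm X.carrier ⥤ Herm Y.carrier where
  obj := hermFunctorObj F
  map f := ⟨F.functor.map f.hom⟩
  map_id x := Herm.hom_ext (F.functor.map_id x.obj)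
  map_comp f g := Herm.hom_ext (F.functor.map_comp f.hom g.hom)

/-- The monoidal structure on the induced functor is that of the underlying functor. -/
instance hermFunctorMonoidal : (hermFunctor F).Monoidal :=
  Functor.CoreMonoidal.toMonoidal
    { εIso := Herm.isoMk (Functor.Monoidal.εIso F.functor)
      μIso := fun x y => Herm.isoMk (Functor.Monoidal.μIso F.functor x.obj y.obj)
      μIso_hom_natural_left := fun f z =>
        Herm.hom_ext (Functor.LaxMonoidal.μ_natural_left F.functor f.hom z.obj)
      μIso_hom_natural_right := fun z f =>
        Herm.hom_ext (Functor.LaxMonoidal.μ_natural_right F.functor z.obj f.hom)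
      associativity := fun x y z =>
        Herm.hom_ext (Functor.LaxMonoidal.associativity F.functor x.obj y.obj z.obj)
      left_unitality := fun x =>
        Herm.hom_ext (Functor.LaxMonoidal.left_unitality F.functor x.obj)
      right_unitality := fun x =>
        Herm.hom_ext (Functor.LaxMonoidal.right_unitality F.functor x.obj) }

lemma hermFunctor_unitary_tensor (x y : Herm X.carrier) :
    IsUnitary (Functor.LaxMonoidal.μ (hermFunctor F) x y) :=
  (Herm.isUnitary_iff_of_iso (Functor.Monoidal.μIso (hermFunctor F) x y)).2 (by
    have h : ((F.phiApp x.obj).hom ⊗ₘ (F.phiApp y.obj).hom) ≫ _ =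
      _ ≫ _ ≫ (F.phiApp (x.obj ⊗ y.obj)).hom ≫ _ := F.phi_tensor x.obj y.obj
    change Functor.LaxMonoidal.μ F.functor x.obj y.obj ≫
      (F.functor.map ((x.pairing.hom ⊗ₘ y.pairing.hom) ≫ (chi x.obj y.obj).hom) ≫
        (F.phiApp (x.obj ⊗ y.obj)).hom) ≫ dMap (Functor.LaxMonoidal.μ F.functor x.obj y.obj) =
      ((F.functor.map x.pairing.hom ≫ (F.phiApp x.obj).hom) ⊗ₘ
        (F.functor.map y.pairing.hom ≫ (F.phiApp y.obj).hom)) ≫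
        (chi (F.functor.obj x.obj) (F.functor.obj y.obj)).hom
    rw [← tensorHom_comp_tensorHom, Category.assoc, Category.assoc, h, Functor.map_comp,
      Category.assoc, Functor.LaxMonoidal.μ_natural_assoc])

end

/-- The Hermitian completion on 1-morphisms. -/
def hermMap {k : Level} {X Y : AICat.{v, u} k} (F : X ⟶ Y) : hermObj X ⟶ hermObj Y :=
  { functor := hermFunctor F
    monoidal := hermFunctorMonoidal F
    map_dag := fun {x y} f => Herm.hom_ext (by
      change F.functor.map (y.pairing.hom ≫ dMap f.hom ≫ x.pairing.inv) =
        (F.functor.map y.pairing.hom ≫ (F.phiApp y.obj).hom) ≫ dMap (F.functor.map f.hom) ≫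
          (F.phiApp x.obj).inv ≫ F.functor.map x.pairing.inv
      have h := F.phi_natural f.hom
      rw [Category.assoc, ← reassoc_of% h, Iso.hom_inv_id_assoc, Functor.map_comp,
        Functor.map_comp])
    unitary_unit := (Herm.isUnitary_iff_of_iso
      (Functor.Monoidal.εIso (hermFunctor F))).2 (by
        have h := F.phi_unit
        change Functor.LaxMonoidal.ε F.functor ≫ (F.functor.map (uIso X.carrier).hom ≫
          F.phi.hom.app (op (𝟙_ X.carrier))) ≫ dMap (Functor.LaxMonoidal.ε F.functor) =
          (uIso Y.carrier).hom
        rw [Category.assoc, h])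
    unitary_tensor := hermFunctor_unitary_tensor F
    isBraided := fun hk x y => Herm.hom_ext (F.isBraided hk x.obj y.obj) }

/-- The Hermitian completion on 2-morphisms. -/
def hermMap₂ {k : Level} {X Y : AICat.{v, u} k} {F G : X ⟶ Y} (τ : F ⟶ G) :
    hermMap F ⟶ hermMap G :=
  { toNatTrans :=
      { app := fun x => ⟨τ.toNatTrans.app x.obj⟩
        naturality := fun _ _ f => Herm.hom_ext (τ.toNatTrans.naturality f.hom) }
    isMonoidal :=
      { unit := Herm.hom_ext τ.isMonoidal.unit
        tensor := fun x y => Herm.hom_ext (τ.isMonoidal.tensor x.obj y.obj) }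
    isometric := fun x => Herm.hom_ext (by
      have h := τ.antiInvolutive x.obj
      change τ.toNatTrans.app x.obj ≫ (G.functor.map x.pairing.hom ≫ (G.phiApp x.obj).hom) ≫
        dMap (τ.toNatTrans.app x.obj) ≫ (F.phiApp x.obj).inv ≫ F.functor.map x.pairing.inv = 𝟙 _
      rw [Category.assoc, ← NatTrans.naturality_assoc]
      have h2 : τ.toNatTrans.app (dObj x.obj) ≫ (G.phiApp x.obj).hom ≫
          dMap (τ.toNatTrans.app x.obj) ≫ (F.phiApp x.obj).inv = 𝟙 _ := by
        rw [← Iso.hom_inv_id (F.phiApp x.obj), h]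
        simp only [Category.assoc]
      have h3 := congrArg (fun t => F.functor.map x.pairing.hom ≫ t ≫
        F.functor.map x.pairing.inv) h2
      simp only [Category.assoc, Category.id_comp] at h3
      refine h3.trans ?_
      rw [← F.functor.map_comp, Iso.hom_inv_id, F.functor.map_id]) }

/-- The action of the Hermitian completion on objects, 1-morphisms and 2-morphisms. -/
def hermData (k : Level) : PrelaxFunctorStruct (AICat.{v, u} k) (DagCat.{v, max u v} k) where
  obj := hermObj
  map := hermMap
  map₂ := hermMap₂

/-! ### Monoidal positivity structures -/

/-- A (closed) monoidal positivity structure: a collection of Hermitian pairings such that every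
object carries one of them, closed under transfer along isomorphisms and under tensor products. -/
structure PositivityStructure (C : Type u) [Category.{v} C] [MonoidalCategory C]
    [MonoidalAntiInvolution C] where
  pos : ObjectProperty (Herm C)
  exists_pos : ∀ c : C, ∃ x : Herm C, pos x ∧ x.obj = c
  transfer_mem : ∀ x : Herm C, pos x → ∀ {c : C} (g : c ≅ x.obj), pos (x.transfer g)
  tensor_mem : ∀ x y : Herm C, pos x → pos y → pos (x ⊗ y)

/-- The canonical pairing of the monoidal unit is automatically positive. -/
lemma PositivityStructure.unit_mem {C : Type u} [Category.{v} C] [MonoidalCategory C]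
    [MonoidalAntiInvolution C] (P : PositivityStructure C) : P.pos (𝟙_ (Herm C)) := by
  obtain ⟨⟨c, h, hh⟩, hx, hc⟩ := P.exists_pos (𝟙_ C)
  dsimp only at hc
  subst hc
  let a : 𝟙_ C ≅ 𝟙_ C := h ≪≫ (uIso C).symm
  have ha : a.hom ≫ (uIso C).hom = h.hom := by
    change (h.hom ≫ (uIso C).inv) ≫ (uIso C).hom = h.hom
    rw [Category.assoc, Iso.inv_hom_id, Category.comp_id]
  have ha2 : (uIso C).hom ≫ dMap a.hom = a.hom ≫ (uIso C).hom := by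
    have h1 : etaApp (𝟙_ C) ≫ dMap h.hom = h.hom := hh
    rw [← ha, dMap_comp, reassoc_of% (etaApp_unit (C := C))] at h1
    exact h1
  have hm := P.transfer_mem _ (P.tensor_mem _ _ hx hx) (a.symm ≪≫ (λ_ (𝟙_ C)).symm)
  convert hm using 1
  refine Herm.ext rfl (heq_of_eq (Iso.ext ?_))
  change (uIso C).hom = (a.inv ≫ (λ_ (𝟙_ C)).inv) ≫ ((h.hom ⊗ₘ h.hom) ≫ (chi (𝟙_ C) (𝟙_ C)).hom) ≫
    dMap (a.inv ≫ (λ_ (𝟙_ C)).inv)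
  have e1 : (h.hom ⊗ₘ h.hom) = (a.hom ⊗ₘ h.hom) ≫ ((uIso C).hom ▷ dObj (𝟙_ C)) := by
    rw [← tensorHom_id, tensorHom_comp_tensorHom, Category.comp_id, ha]
  have e2 : (a.hom ⊗ₘ h.hom) ≫ (λ_ (dObj (𝟙_ C))).hom = (λ_ (𝟙_ C)).hom ≫ a.hom ≫ h.hom := by
    rw [MonoidalCategory.tensorHom_def, Category.assoc, leftUnitor_naturality, unitors_equal,
      rightUnitor_naturality_assoc]
  rw [dMap_comp, e1]
  simp only [Category.assoc]
  have e3 := chi_left_unitality (𝟙_ C)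
  rw [← reassoc_of% e3, reassoc_of% e2, Iso.inv_hom_id_assoc, Iso.inv_hom_id_assoc, ← ha,
    ← ha2, Category.assoc, ← dMap_comp, Iso.inv_hom_id, dMap_id, Category.comp_id]

instance {C : Type u} [Category.{v} C] [MonoidalCategory C] [MonoidalAntiInvolution C]
    (P : PositivityStructure C) : P.pos.IsMonoidal where
  prop_unit := P.unit_mem
  prop_tensor := P.tensor_mem

/-! ### Full dagger subcategories -/

section

variable {D : Type u} [Category.{v} D] [DaggerCategory D] (P : ObjectProperty D)

instance fullDagger : DaggerCategory P.FullSubcategory where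
  dag f := ObjectProperty.homMk (dag f.hom)
  dag_id X := ObjectProperty.hom_ext _ (dag_id X.obj)
  dag_comp f g := ObjectProperty.hom_ext _ (dag_comp f.hom g.hom)
  dag_dag f := ObjectProperty.hom_ext _ (dag_dag f.hom)

lemma full_isUnitary {X Y : P.FullSubcategory} {f : X ⟶ Y} (h : IsUnitary f.hom) :
    IsUnitary f :=
  ⟨ObjectProperty.hom_ext _ h.1, ObjectProperty.hom_ext _ h.2⟩

instance fullMonoidalDagger [MonoidalCategory D] [MonoidalDagger D] [P.IsMonoidal] :
    MonoidalDagger P.FullSubcategory where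
  dag_tensorHom f g := ObjectProperty.hom_ext _ (MonoidalDagger.dag_tensorHom f.hom g.hom)
  unitary_associator X Y Z :=
    full_isUnitary P (MonoidalDagger.unitary_associator X.obj Y.obj Z.obj)
  unitary_leftUnitor X := full_isUnitary P (MonoidalDagger.unitary_leftUnitor X.obj)
  unitary_rightUnitor X := full_isUnitary P (MonoidalDagger.unitary_rightUnitor X.obj)

end

namespace DagCat

variable {k : Level}

/-- The full dagger subcategory on a collection of objects containing the unit and closed under
tensor products. -/
def full (D : DagCat.{v, u} k) (P : ObjectProperty D.carrier) [P.IsMonoidal] :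
    DagCat.{v, u} k where
  carrier := P.FullSubcategory
  braiding :=
    { braiding := fun hk => letI := D.braiding.braiding hk; P.fullBraidedSubcategory
      symmetric := fun h hk X Y =>
        ObjectProperty.hom_ext _ (D.braiding.symmetric h hk X.obj Y.obj) }
  isUnitary := fun hk X Y => full_isUnitary P (D.isUnitary hk X.obj Y.obj)

/-- The restriction of a monoidal functor to full subcategories. -/
instance restrictMonoidal {C : Type u₁} [Category.{v₁} C] [MonoidalCategory C] {D : Type u₂}
    [Category.{v₂} D] [MonoidalCategory D] (P : ObjectProperty C) [P.IsMonoidal]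
    (Q : ObjectProperty D) [Q.IsMonoidal] (F : C ⥤ D) [F.Monoidal]
    (h : ∀ x : P.FullSubcategory, Q ((P.ι ⋙ F).obj x)) : (Q.lift (P.ι ⋙ F) h).Monoidal :=
  Functor.CoreMonoidal.toMonoidal
    { εIso := Q.isoMk (Functor.Monoidal.εIso F)
      μIso := fun x y => Q.isoMk (Functor.Monoidal.μIso F x.obj y.obj)
      μIso_hom_natural_left := fun f z => ObjectProperty.hom_ext _
        (Functor.LaxMonoidal.μ_natural_left F f.hom z.obj)
      μIso_hom_natural_right := fun z f => ObjectProperty.hom_ext _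
        (Functor.LaxMonoidal.μ_natural_right F z.obj f.hom)
      associativity := fun x y z => ObjectProperty.hom_ext _
        (Functor.LaxMonoidal.associativity F x.obj y.obj z.obj)
      left_unitality := fun x => ObjectProperty.hom_ext _
        (Functor.LaxMonoidal.left_unitality F x.obj)
      right_unitality := fun x => ObjectProperty.hom_ext _
        (Functor.LaxMonoidal.right_unitality F x.obj) }

/-- The restriction of a 1-morphism to full dagger subcategories. -/
def restrict {D E : DagCat.{v, u} k} (F : D ⟶ E) (P : ObjectProperty D.carrier) [P.IsMonoidal]
    (Q : ObjectProperty E.carrier) [Q.IsMonoidal] (h : ∀ x, P x → Q (F.functor.obj x)) :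
    D.full P ⟶ E.full Q :=
  { functor := Q.lift (P.ι ⋙ F.functor) (fun x => h x.obj x.property)
    monoidal := restrictMonoidal P Q F.functor (fun x => h x.obj x.property)
    map_dag := fun f => ObjectProperty.hom_ext _ (F.map_dag f.hom)
    unitary_unit := full_isUnitary Q F.unitary_unit
    unitary_tensor := fun x y => full_isUnitary Q (F.unitary_tensor x.obj y.obj)
    isBraided := fun hk x y => ObjectProperty.hom_ext _ (F.isBraided hk x.obj y.obj) }

/-- The restriction of a 2-morphism to full dagger subcategories. -/
def restrict₂ {D E : DagCat.{v, u} k} {F G : D ⟶ E} (τ : F ⟶ G) (P : ObjectProperty D.carrier)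
    [P.IsMonoidal] (Q : ObjectProperty E.carrier) [Q.IsMonoidal]
    (hF : ∀ x, P x → Q (F.functor.obj x)) (hG : ∀ x, P x → Q (G.functor.obj x)) :
    restrict F P Q hF ⟶ restrict G P Q hG :=
  { toNatTrans :=
      { app := fun x => ObjectProperty.homMk (τ.toNatTrans.app x.obj)
        naturality := fun _ _ f => ObjectProperty.hom_ext _ (τ.toNatTrans.naturality f.hom) }
    isMonoidal :=
      { unit := ObjectProperty.hom_ext _ τ.isMonoidal.unit
        tensor := fun x y => ObjectProperty.hom_ext _ (τ.isMonoidal.tensor x.obj y.obj) }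
    isometric := fun x => ObjectProperty.hom_ext _ (τ.isometric x.obj) }

end DagCat

/-! ### Anti-involutive categories with a positivity structure -/

/-- A (braided, symmetric) monoidal anti-involutive category equipped with a monoidal positivity
structure. -/
structure AIPosCat (k : Level) where
  toAICat : AICat.{v, u} k
  positivity : PositivityStructure toAICat.carrier

namespace AIPosCat

variable {k : Level}

/-- A 1-morphism: a (braided, symmetric) monoidal anti-involutive functor that sends positive
pairings to positive pairings. -/
structure Hom (X Y : AIPosCat.{v, u} k) where
  hom : X.toAICat ⟶ Y.toAICat
  preserves : ∀ x, X.positivity.pos x → Y.positivity.pos (hermFunctorObj hom x)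

/-- A 2-morphism: any 2-morphism of the underlying anti-involutive functors. -/
structure Hom₂ {X Y : AIPosCat.{v, u} k} (F G : Hom X Y) where
  hom : F.hom ⟶ G.hom

lemma hom_ext' {X Y : AIPosCat.{v, u} k} {F G : Hom X Y} (h : F.hom = G.hom) : F = G := by
  cases F
  cases G
  cases h
  rfl

lemma hermFunctorObj_id (X : AICat.{v, u} k) (x : Herm X.carrier) :
    hermFunctorObj (𝟙 X) x = x :=
  Herm.ext rfl (heq_of_eq (Iso.ext (Category.comp_id x.pairing.hom)))

lemma hermFunctorObj_comp {X Y Z : AICat.{v, u} k} (F : X ⟶ Y) (G : Y ⟶ Z)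
    (x : Herm X.carrier) :
    hermFunctorObj (F ≫ G) x = hermFunctorObj G (hermFunctorObj F x) :=
  Herm.ext rfl (heq_of_eq (Iso.ext (by
    change G.functor.map (F.functor.map x.pairing.hom) ≫ G.functor.map (F.phiApp x.obj).hom ≫
      (G.phiApp (F.functor.obj x.obj)).hom =
      G.functor.map (F.functor.map x.pairing.hom ≫ (F.phiApp x.obj).hom) ≫
        (G.phiApp (F.functor.obj x.obj)).hom
    rw [Functor.map_comp, Category.assoc])))

instance : CategoryStruct (AIPosCat.{v, u} k) where
  Hom := Hom
  id X := ⟨𝟙 X.toAICat, fun x hx => by rwa [hermFunctorObj_id]⟩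
  comp F G := ⟨F.hom ≫ G.hom, fun x hx => by
    rw [hermFunctorObj_comp]
    exact G.preserves _ (F.preserves x hx)⟩

instance homCategory (X Y : AIPosCat.{v, u} k) : Category (X ⟶ Y) where
  Hom F G := Hom₂ F G
  id F := ⟨𝟙 F.hom⟩
  comp σ τ := ⟨σ.hom ≫ τ.hom⟩
  id_comp _ := by congr 1; exact Category.id_comp _
  comp_id _ := by congr 1; exact Category.comp_id _
  assoc _ _ _ := by congr 1; exact Category.assoc _ _ _

lemma hom₂_ext {X Y : AIPosCat.{v, u} k} {F G : X ⟶ Y} {σ τ : F ⟶ G} (h : σ.hom = τ.hom) :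
    σ = τ := by
  obtain ⟨s⟩ := σ
  obtain ⟨t⟩ := τ
  obtain rfl : s = t := h
  rfl

/-- An invertible 2-morphism from one between the underlying 1-morphisms. -/
def isoMk {X Y : AIPosCat.{v, u} k} (F G : X ⟶ Y) (e : Hom.hom F ≅ Hom.hom G) : F ≅ G where
  hom := ⟨e.hom⟩
  inv := ⟨e.inv⟩
  hom_inv_id := hom₂_ext e.hom_inv_id
  inv_hom_id := hom₂_ext e.inv_hom_id

instance bicategory : Bicategory (AIPosCat.{v, u} k) where
  homCategory := homCategory
  whiskerLeft {_ _ _} F {_ _} τ := ⟨Bicategory.whiskerLeft F.hom τ.hom⟩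
  whiskerRight {_ _ _ _ _} τ H := ⟨Bicategory.whiskerRight τ.hom H.hom⟩
  associator F G H := isoMk _ _ (Bicategory.associator F.hom G.hom H.hom)
  leftUnitor F := isoMk _ _ (Bicategory.leftUnitor F.hom)
  rightUnitor F := isoMk _ _ (Bicategory.rightUnitor F.hom)
  whiskerLeft_id _ _ := hom₂_ext (Bicategory.whiskerLeft_id _ _)
  whiskerLeft_comp _ _ _ _ _ _ := hom₂_ext (Bicategory.whiskerLeft_comp _ _ _)
  id_whiskerLeft _ := hom₂_ext (Bicategory.id_whiskerLeft _)
  comp_whiskerLeft _ _ _ _ _ := hom₂_ext (Bicategory.comp_whiskerLeft _ _ _)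
  id_whiskerRight _ _ := hom₂_ext (Bicategory.id_whiskerRight _ _)
  comp_whiskerRight _ _ _ := hom₂_ext (Bicategory.comp_whiskerRight _ _ _)
  whiskerRight_id _ := hom₂_ext (Bicategory.whiskerRight_id _)
  whiskerRight_comp _ _ _ := hom₂_ext (Bicategory.whiskerRight_comp _ _ _)
  whisker_assoc _ _ _ _ _ := hom₂_ext (Bicategory.whisker_assoc _ _ _)
  whisker_exchange _ _ := hom₂_ext (Bicategory.whisker_exchange _ _)
  pentagon _ _ _ _ := hom₂_ext (Bicategory.pentagon _ _ _ _)
  triangle _ _ := hom₂_ext (Bicategory.triangle _ _)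

lemma eqToHom_hom {X Y : AIPosCat.{v, u} k} {F G : X ⟶ Y} (h : F = G) :
    Hom₂.hom (eqToHom h) = eqToHom (congrArg (fun K : Hom X Y => K.hom) h) := by
  subst h
  rfl

lemma eqToIso_hom_hom {X Y : AIPosCat.{v, u} k} {F G : X ⟶ Y} (h : F = G) :
    Hom₂.hom (eqToIso h).hom = (eqToIso (congrArg (fun K : Hom X Y => K.hom) h)).hom := by
  subst h
  rfl

lemma id_comp' {X Y : AIPosCat.{v, u} k} (F : X ⟶ Y) : 𝟙 X ≫ F = F :=
  hom_ext' (Bicategory.Strict.id_comp F.hom)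

lemma comp_id' {X Y : AIPosCat.{v, u} k} (F : X ⟶ Y) : F ≫ 𝟙 Y = F :=
  hom_ext' (Bicategory.Strict.comp_id F.hom)

lemma assoc' {W X Y Z : AIPosCat.{v, u} k} (F : W ⟶ X) (G : X ⟶ Y) (H : Y ⟶ Z) :
    (F ≫ G) ≫ H = F ≫ G ≫ H :=
  hom_ext' (Bicategory.Strict.assoc F.hom G.hom H.hom)

instance strict : Bicategory.Strict (AIPosCat.{v, u} k) where
  id_comp := id_comp'
  comp_id := comp_id'
  assoc := assoc'
  leftUnitor_eqToIso F := Iso.ext (hom₂_ext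
    ((congrArg Iso.hom (Bicategory.Strict.leftUnitor_eqToIso F.hom)).trans
      (eqToIso_hom_hom (id_comp' F)).symm))
  rightUnitor_eqToIso F := Iso.ext (hom₂_ext
    ((congrArg Iso.hom (Bicategory.Strict.rightUnitor_eqToIso F.hom)).trans
      (eqToIso_hom_hom (comp_id' F)).symm))
  associator_eqToIso F G H := Iso.ext (hom₂_ext
    ((congrArg Iso.hom (Bicategory.Strict.associator_eqToIso F.hom G.hom H.hom)).trans
      (eqToIso_hom_hom (assoc' F G H)).symm))

end AIPosCat

/-- The positive pairings, as a collection of objects of the Hermitian completion. -/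
def AIPosCat.positive {k : Level} (X : AIPosCat.{v, u} k) :
    ObjectProperty (hermObj X.toAICat).carrier :=
  X.positivity.pos

instance AIPosCat.positive_isMonoidal {k : Level} (X : AIPosCat.{v, u} k) :
    X.positive.IsMonoidal where
  prop_unit := X.positivity.unit_mem
  prop_tensor := X.positivity.tensor_mem

/-- The action of `(C, P) ↦ C_P` on objects, 1-morphisms and 2-morphisms, where `C_P` is the full
dagger subcategory of the Hermitian completion of `C` on the positive pairings. -/
def hermPosData (k : Level) :
    PrelaxFunctorStruct (AIPosCat.{v, u} k) (DagCat.{v, max u v} k) where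
  obj X := (hermObj X.toAICat).full X.positive
  map {X Y} F := DagCat.restrict (hermMap F.hom) X.positive Y.positive F.preserves
  map₂ {X Y F G} τ := DagCat.restrict₂ (hermMap₂ τ.hom) X.positive Y.positive
    F.preserves G.preserves

/-! ### The canonical positivity structure of a dagger category -/

section

variable {C : Type u} [Category.{v} C] [DaggerCategory C]

lemma IsIsoPositive.id (X : C) : IsIsoPositive (𝟙 X) :=
  ⟨X, Iso.refl X, by rw [Iso.refl_hom, dag_id, Category.comp_id]⟩

lemma IsIsoPositive.transfer {X Y : C} {f : X ⟶ X} (hf : IsIsoPositive f) (e : Y ≅ X) :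
    IsIsoPositive (e.hom ≫ f ≫ dag e.hom) := by
  obtain ⟨Z, g, rfl⟩ := hf
  refine ⟨Z, e ≪≫ g, ?_⟩
  rw [Iso.trans_hom, dag_comp]
  simp only [Category.assoc]

lemma IsIsoPositive.tensor [MonoidalCategory C] [MonoidalDagger C] {X Y : C} {f : X ⟶ X}
    {f' : Y ⟶ Y} (hf : IsIsoPositive f) (hf' : IsIsoPositive f') :
    IsIsoPositive ((f ⊗ₘ f') ≫ 𝟙 (X ⊗ Y)) := by
  obtain ⟨Z, g, rfl⟩ := hf
  obtain ⟨Z', g', rfl⟩ := hf'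
  refine ⟨Z ⊗ Z', MonoidalCategory.tensorIso g g', ?_⟩
  rw [MonoidalCategory.tensorIso_hom, MonoidalDagger.dag_tensorHom, tensorHom_comp_tensorHom,
    Category.comp_id]

end

lemma IsIsoPositive.map {k : Level} {D E : DagCat.{v, u} k} (F : D ⟶ E) {X : D.carrier}
    {f : X ⟶ X} (hf : IsIsoPositive f) :
    IsIsoPositive (F.functor.map f ≫ 𝟙 (F.functor.obj X)) := by
  obtain ⟨Z, g, rfl⟩ := hf
  refine ⟨F.functor.obj Z, F.functor.mapIso g, ?_⟩
  rw [F.functor.mapIso_hom, ← F.map_dag, ← F.functor.map_comp, Category.comp_id]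

/-- The positivity structure `Pos(D)` on a monoidal dagger category `D`, regarded as an
anti-involutive category: the pairings of the form `g† ∘ g` with `g` an isomorphism. -/
def canonicalPositivity {k : Level} (D : DagCat.{v, u} k) :
    PositivityStructure (canonicalObj D).carrier where
  pos x := IsIsoPositive (C := D.carrier) (X := x.obj) x.pairing.hom
  exists_pos c :=
    ⟨⟨c, Iso.refl (C := D.carrier) c, (Category.id_comp _).trans (dag_id (C := D.carrier) c)⟩,
      IsIsoPositive.id (C := D.carrier) c, rfl⟩
  transfer_mem _ hx _ e := IsIsoPositive.transfer (C := D.carrier) hx e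
  tensor_mem _ _ hx hx' := IsIsoPositive.tensor (C := D.carrier) hx hx'

lemma canonicalPositivity_map {k : Level} {D E : DagCat.{v, u} k} (F : D ⟶ E)
    (x : Herm (canonicalObj D).carrier) (hx : (canonicalPositivity D).pos x) :
    (canonicalPositivity E).pos (hermFunctorObj (canonicalMap F) x) :=
  IsIsoPositive.map F (X := x.obj) hx

lemma canonicalPos_eqToHom_app {k : Level} {D E : DagCat.{v, u} k}
    {F G : (⟨canonicalObj D, canonicalPositivity D⟩ : AIPosCat.{v, u} k) ⟶
      ⟨canonicalObj E, canonicalPositivity E⟩} (h : F = G) (x : D.carrier) :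
    (AIPosCat.Hom₂.hom (eqToHom h)).toNatTrans.app x =
      eqToHom (congrArg (fun K : AIPosCat.Hom _ _ => (AIPosCat.Hom.hom K).functor.obj x) h) := by
  subst h
  rfl

/-- The 2-functor `D ↦ (D, Pos(D))`, lifting the canonical 2-functor. -/
def canonicalPos (k : Level) : StrictPseudofunctor (DagCat.{v, u} k) (AIPosCat.{v, u} k) :=
  StrictPseudofunctor.mk''
    { obj := fun D => ⟨canonicalObj D, canonicalPositivity D⟩
      map := fun F => ⟨canonicalMap F, canonicalPositivity_map F⟩
      map₂ := fun τ => ⟨canonicalMap₂ τ⟩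
      map₂_id := fun _ => rfl
      map₂_comp := fun _ _ => rfl
      map_id := fun X => AIPosCat.hom_ext' ((canonical k).map_id X)
      map_comp := fun F G => AIPosCat.hom_ext' (canonical_map_comp F G)
      map₂_whisker_left := fun {_ _ _} F {G H} τ => AIPosCat.hom₂_ext (AICat.hom₂_ext fun x =>
        (whisker_aux (canonicalPos_eqToHom_app (AIPosCat.hom_ext' (canonical_map_comp F G)) x)
          (canonicalPos_eqToHom_app (AIPosCat.hom_ext' (canonical_map_comp F H).symm) x)
          (τ.toNatTrans.app (F.functor.obj x))))
      map₂_whisker_right := fun {_ _ _ F G} τ H => AIPosCat.hom₂_ext (AICat.hom₂_ext fun x =>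
        (whisker_aux (canonicalPos_eqToHom_app (AIPosCat.hom_ext' (canonical_map_comp F H)) x)
          (canonicalPos_eqToHom_app (AIPosCat.hom_ext' (canonical_map_comp G H).symm) x)
          (H.functor.map (τ.toNatTrans.app x)))) }

/-! ### Strict 2-natural transformations, strict 2-adjunctions, equivalences -/

section

universe w₁ w₂ v₃ v₄ u₃ u₄

variable {B : Type u₃} [Bicategory.{w₁, v₃} B] {C : Type u₄} [Bicategory.{w₂, v₄} C]

/-- A strict 2-natural transformation between strict 2-functors. -/
structure TwoNatTrans (F G : StrictPseudofunctor B C) where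
  app : ∀ X : B, F.obj X ⟶ G.obj X
  naturality : ∀ {X Y : B} (f : X ⟶ Y), F.map f ≫ app Y = app X ≫ G.map f
  naturality₂ : ∀ {X Y : B} {f g : X ⟶ Y} (η : f ⟶ g),
    Bicategory.whiskerRight (F.map₂ η) (app Y) ≫ eqToHom (naturality g) =
      eqToHom (naturality f) ≫ Bicategory.whiskerLeft (app X) (G.map₂ η)

/-- A strict 2-adjunction `L ⊣ R`: a unit and a counit which are strictly 2-natural and satisfy the
triangle identities on the nose. -/
structure TwoAdjunction (L : StrictPseudofunctor B C) (R : StrictPseudofunctor C B) where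
  unit : TwoNatTrans (StrictPseudofunctor.id B) (L.comp R)
  counit : TwoNatTrans (R.comp L) (StrictPseudofunctor.id C)
  left_triangle : ∀ X : B, L.map (unit.app X) ≫ counit.app (L.obj X) = 𝟙 (L.obj X)
  right_triangle : ∀ Y : C, unit.app (R.obj Y) ≫ R.map (counit.app Y) = 𝟙 (R.obj Y)

/-- A 1-morphism that is an (internal) equivalence. -/
def IsEquivalence {X Y : B} (f : X ⟶ Y) : Prop :=
  ∃ e : Bicategory.Equivalence X Y, e.hom = f

end

end DaggerHerm

namespace DaggerHerm

open DaggerCategory (dag dag_id dag_comp dag_dag)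

variable {k : Level}

/-! ### Equality of 1-morphisms and 2-morphisms of dagger categories -/

/-! The adjunction has an explicit unit and counit. For a dagger category `D` the unit sends `x` to
`(x, id)` and is the identity on morphisms: with `d = †` and `η = id` the identity is a Hermitian
pairing, and conjugating by identities leaves `†` unchanged. For an anti-involutive `C` the counit
forgets the pairing, and its comparison isomorphism at `(c, h)` is `h` itself. Each axiom for this
comparison is part of the definition of `Herm C`: naturality is the formula `f† = h₁⁻¹ ∘ d f ∘ h₂`,
compatibility with `η` is Hermiticity of `h`, and monoidality is the choice of pairings on tensor
products and on the unit. Both triangle identities come down to `h ∘ id = h`.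

With positivity the same unit and counit are used, cut down to full subcategories. The unit lands in
`Pos(D)` because identities are iso-positive. The counit preserves positivity
(`hermCounit_positive`): if an automorphism of `(c, h)` is `g† ∘ g` with `g : (c, h) → (c', h')` an
isomorphism in `C_P`, then `h ∘ g† ∘ g = d g ∘ h' ∘ g`, a transfer of the positive pairing `h'`.
Naturality and the left triangle are then reduced to the case without positivity by composing with
the inclusion of `C_P` into `Herm C`; the right triangle is checked on underlying data.

Positivity is what makes the unit and counit invertible. A positive pairing on `x` in `D` is `g† ∘
g` for some `g : x ≅ y`, so `g` is a unitary isomorphism from `(x, g† ∘ g)` to `(y, id)`. Choosing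
such a `g` for every object and conjugating by it gives an inverse of the unit; `conj_dag` and
`conj_tensor_isUnitary` show that it is a monoidal dagger functor. For the counit, every object of
`C` carries a positive pairing; choosing one for each object gives a functor that is the identity on
morphisms, with comparison isomorphisms the inverses of the chosen pairings.

The remaining difficulty is strictness. Equalities of 1-morphisms into `Herm C` involve equalities
of pairings that are not definitional, so 1-morphisms are compared with heterogeneous equality, and
the `eqToHom` terms in the 2-dimensional laws are removed by observing that their underlying
morphisms in `C` are identities. -/

lemma DagCat.Hom.ext_heq {X Y : DagCat.{v, u} k} {F G : X ⟶ Y}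
    (hobj : ∀ x, F.functor.obj x = G.functor.obj x)
    (hmap : ∀ {x y : X.carrier} (f : x ⟶ y), F.functor.map f ≍ G.functor.map f)
    (hε : Functor.LaxMonoidal.ε F.functor ≍ Functor.LaxMonoidal.ε G.functor)
    (hμ : ∀ x y, Functor.LaxMonoidal.μ F.functor x y ≍ Functor.LaxMonoidal.μ G.functor x y) :
    F = G := by
  obtain ⟨F, _, _, _⟩ := F
  obtain ⟨G, _, _, _⟩ := G
  -- Once the underlying functors are identified, the heterogeneous hypotheses become equalities of
  -- structure maps. The remaining fields are propositions, apart from the inverse structure maps,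
  -- which the lax ones determine.
  obtain rfl : F = G := Functor.hext hobj fun _ _ f => hmap f
  exact DagCat.Hom.mk_eq (eq_of_heq hε) (funext fun x => funext fun y => eq_of_heq (hμ x y))

lemma DagCat.eqToHom_app {X Y : DagCat.{v, u} k} {F G : X ⟶ Y} (h : F = G) (x : X.carrier) :
    (DagCat.Hom₂.toNatTrans (eqToHom h)).app x =
      eqToHom (congrArg (fun K : DagCat.Hom X Y => K.functor.obj x) h) := by
  subst h
  rfl

namespace Herm

variable {C : Type u} [Category.{v} C] [AntiInvolution C]

lemma ext_pairing {c : C} {h h' : c ≅ dObj c} {hh : IsHermitian h} {hh' : IsHermitian h'}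
    (e : h.hom = h'.hom) : (⟨c, h, hh⟩ : Herm C) = ⟨c, h', hh'⟩ :=
  Herm.ext rfl (heq_of_eq (Iso.ext e))

/-- Morphisms of `Herm C` ignore the pairings. So when endpoints differ only by a propositional
equality of pairings, the underlying morphisms are often definitionally equal and `HEq.rfl` settles
the comparison. -/
lemma hom_heq {X X' Y Y' : Herm C} (hX : X = X') (hY : Y = Y') {f : X ⟶ Y} {g : X' ⟶ Y'}
    (h : f.hom ≍ g.hom) : f ≍ g := by
  subst hX hY
  exact heq_of_eq (hom_ext (eq_of_heq h))

/-- The dagger of `Herm C` is the unique one for which the pairings form a natural transformation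
from `†` to `d`. This is the naturality of the counit's comparison isomorphism. -/
lemma dag_hom_comp_pairing {X Y : Herm C} (f : X ⟶ Y) :
    (dag f).hom ≫ X.pairing.hom = Y.pairing.hom ≫ dMap f.hom := by
  rw [dag_hom, Category.assoc, Category.assoc, Iso.inv_hom_id, Category.comp_id]

end Herm

lemma hermObj_ext {X : DagCat.{v, max u v} k} {Y : AICat.{v, u} k} {F G : X ⟶ hermObj Y}
    (hobj : ∀ x, F.functor.obj x = G.functor.obj x)
    (hmap : ∀ {x y : X.carrier} (f : x ⟶ y), (F.functor.map f).hom ≍ (G.functor.map f).hom)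
    (hε : (Functor.LaxMonoidal.ε F.functor).hom ≍ (Functor.LaxMonoidal.ε G.functor).hom)
    (hμ : ∀ x y, (Functor.LaxMonoidal.μ F.functor x y).hom ≍
      (Functor.LaxMonoidal.μ G.functor x y).hom) : F = G :=
  DagCat.Hom.ext_heq hobj (fun f => Herm.hom_heq (hobj _) (hobj _) (hmap f))
    (Herm.hom_heq rfl (hobj _) hε)
    (fun x y => Herm.hom_heq (congrArg₂ Herm.tensor (hobj x) (hobj y)) (hobj _) (hμ x y))

/-- In the applications both objects of `Y` are definitionally the same, only their pairings being
propositionally equal, so the right-hand side is an identity. -/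
lemma hermObj_eqToHom_app_hom {X : DagCat.{v, max u v} k} {Y : AICat.{v, u} k}
    {F G : X ⟶ hermObj Y} (h : F = G) (x : X.carrier) :
    ((DagCat.Hom₂.toNatTrans (eqToHom h)).app x).hom =
      eqToHom (congrArg (fun K : DagCat.Hom X (hermObj Y) => (K.functor.obj x).obj) h) := by
  subst h
  rfl

/-! ### The Hermitian completion as a strict 2-functor -/

lemma hermMap_id (X : AICat.{v, u} k) : hermMap (𝟙 X) = 𝟙 (hermObj X) :=
  hermObj_ext (AIPosCat.hermFunctorObj_id X) (fun _ => HEq.rfl) HEq.rfl fun _ _ => HEq.rfl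

/-- Only the objects require an argument: the two pairings on the image differ by functoriality of
`G` and associativity. Morphisms and structure maps agree definitionally after forgetting the
pairings. -/
lemma hermMap_comp {X Y Z : AICat.{v, u} k} (F : X ⟶ Y) (G : Y ⟶ Z) :
    hermMap (F ≫ G) = hermMap F ≫ hermMap G :=
  hermObj_ext (AIPosCat.hermFunctorObj_comp F G) (fun _ => HEq.rfl) HEq.rfl fun _ _ => HEq.rfl

/-- The Hermitian completion as a strict 2-functor. -/
def hermTwoFunctor (k : Level) :
    StrictPseudofunctor (AICat.{v, u} k) (DagCat.{v, max u v} k) :=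
  StrictPseudofunctor.mk''
    { toPrelaxFunctorStruct := hermData k
      map₂_id := fun _ => rfl
      map₂_comp := fun _ _ => rfl
      map_id := hermMap_id
      map_comp := hermMap_comp
      -- The two whiskered transformations have definitionally equal underlying components;
      -- `whisker_aux` absorbs the two coherence 2-morphisms, which are identities in the underlying
      -- category.
      map₂_whisker_left := fun {_ _ _} F {G H} τ => DagCat.hom₂_ext fun x => Herm.hom_ext
        (whisker_aux (hermObj_eqToHom_app_hom (hermMap_comp F G) x)
          (hermObj_eqToHom_app_hom (hermMap_comp F H).symm x)
          (τ.toNatTrans.app (F.functor.obj x.obj)))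
      map₂_whisker_right := fun {_ _ _ F G} τ H => DagCat.hom₂_ext fun x => Herm.hom_ext
        (whisker_aux (hermObj_eqToHom_app_hom (hermMap_comp F H) x)
          (hermObj_eqToHom_app_hom (hermMap_comp G H).symm x)
          (H.functor.map (τ.toNatTrans.app x.obj))) }

/-! ### The unit of the adjunction -/

section

-- An object of `Herm C` contains a morphism of `C`, so the object universe must absorb `v` for both
-- 2-functors to relate the same pair of 2-categories.
variable (D : DagCat.{v, max u v} k)

/-- An object of a dagger category with the identity pairing. -/
def hermUnitObj (x : D.carrier) : Herm (canonicalObj D).carrier where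
  obj := x
  pairing := Iso.refl (C := D.carrier) x
  hermitian := (Category.id_comp _).trans (dag_id (C := D.carrier) x)

/-- The functor equipping each object of a dagger category with the identity pairing. -/
def hermUnitFunctor : D.carrier ⥤ Herm (canonicalObj D).carrier where
  obj := hermUnitObj D
  map f := ⟨f⟩

instance hermUnitMonoidal : (hermUnitFunctor D).Monoidal :=
  Functor.CoreMonoidal.toMonoidal
    { εIso := Herm.isoMk (Iso.refl (C := D.carrier) (𝟙_ D.carrier))
      μIso := fun x y => Herm.isoMk (Iso.refl (C := D.carrier) (x ⊗ y))
      μIso_hom_natural_left := fun {x y} f z => Herm.hom_ext (by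
        change (f ▷ z) ≫ 𝟙 (y ⊗ z) = 𝟙 (x ⊗ z) ≫ f ▷ z
        simp)
      μIso_hom_natural_right := fun {x y} z f => Herm.hom_ext (by
        change (z ◁ f) ≫ 𝟙 (z ⊗ y) = 𝟙 (z ⊗ x) ≫ z ◁ f
        simp)
      associativity := fun x y z => Herm.hom_ext (by
        change 𝟙 (x ⊗ y) ▷ z ≫ 𝟙 ((x ⊗ y) ⊗ z) ≫ (α_ x y z).hom =
          (α_ x y z).hom ≫ x ◁ 𝟙 (y ⊗ z) ≫ 𝟙 (x ⊗ y ⊗ z)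
        simp)
      left_unitality := fun x => Herm.hom_ext (by
        change (λ_ x).hom = 𝟙 (𝟙_ D.carrier) ▷ x ≫ 𝟙 (𝟙_ D.carrier ⊗ x) ≫ (λ_ x).hom
        simp)
      right_unitality := fun x => Herm.hom_ext (by
        change (ρ_ x).hom = x ◁ 𝟙 (𝟙_ D.carrier) ≫ 𝟙 (x ⊗ 𝟙_ D.carrier) ≫ (ρ_ x).hom
        simp) }

/-- The unit of the adjunction between the canonical 2-functor and the Hermitian completion. -/
def hermUnit : D ⟶ hermObj (canonicalObj D) :=
  { functor := hermUnitFunctor D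
    monoidal := hermUnitMonoidal D
    map_dag := fun {x y} f => Herm.hom_ext (by
      change dag f = 𝟙 y ≫ dag f ≫ 𝟙 x
      simp)
    unitary_unit := (Herm.isUnitary_iff_of_iso
      (Functor.Monoidal.εIso (hermUnitFunctor D))).2 (by
        change 𝟙 (𝟙_ D.carrier) ≫ 𝟙 _ ≫ dag (𝟙 (𝟙_ D.carrier)) = 𝟙 _
        simp [dag_id])
    unitary_tensor := fun x y => (Herm.isUnitary_iff_of_iso
      (Functor.Monoidal.μIso (hermUnitFunctor D) x y)).2 (by
        change 𝟙 (x ⊗ y) ≫ 𝟙 _ ≫ dag (𝟙 (x ⊗ y)) = (𝟙 x ⊗ₘ 𝟙 y) ≫ 𝟙 (x ⊗ y)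
        simp [dag_id])
    isBraided := fun hk x y => Herm.hom_ext
      ((Category.id_comp (D.braiding.beta hk x y).hom).trans
        (Category.comp_id (D.braiding.beta hk x y).hom).symm) }

end

/-- Since `canonicalMap F` has trivial comparison isomorphism, the pairing it induces on `F x` from
the identity pairing is `F(id) = id`. -/
lemma hermUnit_naturality {D E : DagCat.{v, max u v} k} (F : D ⟶ E) :
    F ≫ hermUnit E = hermUnit D ≫ hermMap (canonicalMap F) :=
  hermObj_ext
    (fun x => Herm.ext_pairing (((Category.comp_id (F.functor.map (𝟙 x))).trans
      (F.functor.map_id x)).symm))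
    (fun _ => HEq.rfl)
    (heq_of_eq ((Category.id_comp (Functor.LaxMonoidal.ε F.functor)).trans
      ((congrArg (_ ≫ ·) (F.functor.map_id _)).trans (Category.comp_id _)).symm))
    (fun x y => heq_of_eq ((Category.id_comp (Functor.LaxMonoidal.μ F.functor x y)).trans
      ((congrArg (_ ≫ ·) (F.functor.map_id _)).trans (Category.comp_id _)).symm))

/-! ### The counit of the adjunction -/

section

variable (C : AICat.{v, max u v} k)

instance forgetMonoidal : (Herm.forget C.carrier).Monoidal :=
  Functor.CoreMonoidal.toMonoidal
    { εIso := Iso.refl (𝟙_ C.carrier)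
      μIso := fun x y => Iso.refl (x.obj ⊗ y.obj)
      μIso_hom_natural_left := fun {x y} f z => by
        change (f.hom ▷ z.obj) ≫ 𝟙 (y.obj ⊗ z.obj) = 𝟙 (x.obj ⊗ z.obj) ≫ f.hom ▷ z.obj
        simp
      μIso_hom_natural_right := fun {x y} z f => by
        change (z.obj ◁ f.hom) ≫ 𝟙 (z.obj ⊗ y.obj) = 𝟙 (z.obj ⊗ x.obj) ≫ z.obj ◁ f.hom
        simp
      associativity := fun x y z => by
        change 𝟙 (x.obj ⊗ y.obj) ▷ z.obj ≫ 𝟙 ((x.obj ⊗ y.obj) ⊗ z.obj) ≫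
          (α_ x.obj y.obj z.obj).hom =
          (α_ x.obj y.obj z.obj).hom ≫ x.obj ◁ 𝟙 (y.obj ⊗ z.obj) ≫ 𝟙 (x.obj ⊗ y.obj ⊗ z.obj)
        simp
      left_unitality := fun x => by
        change (λ_ x.obj).hom =
          𝟙 (𝟙_ C.carrier) ▷ x.obj ≫ 𝟙 (𝟙_ C.carrier ⊗ x.obj) ≫ (λ_ x.obj).hom
        simp
      right_unitality := fun x => by
        change (ρ_ x.obj).hom =
          x.obj ◁ 𝟙 (𝟙_ C.carrier) ≫ 𝟙 (x.obj ⊗ 𝟙_ C.carrier) ≫ (ρ_ x.obj).hom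
        simp }

/-- The counit of the adjunction between the canonical 2-functor and the Hermitian completion:
the comparison isomorphism on `(c, h)` is `h`. -/
def hermCounit : canonicalObj (hermObj C) ⟶ C :=
  { functor := Herm.forget C.carrier
    monoidal := forgetMonoidal C
    -- On the source, `d` is the identity on objects, so the component at `(c, h)` has to be a
    -- morphism `c ⟶ dObj c`, and `h` is one.
    phi := NatIso.ofComponents (fun x => Herm.pairing (C := C.carrier) (unop x))
      (fun f => Herm.dag_hom_comp_pairing (C := C.carrier) f.unop)
    phi_eta := fun x =>
      (Category.id_comp (Herm.pairing (C := C.carrier) x).hom).trans (Herm.pairing_dMap x).symm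
    phi_unit := by
      change 𝟙 _ ≫ 𝟙 (𝟙_ C.carrier) ≫ (uIso C.carrier).hom ≫ dMap (𝟙 (𝟙_ C.carrier)) = _
      simp only [dMap_id, Category.comp_id, Category.id_comp]
    phi_tensor := fun x y => by
      change ((Herm.pairing (C := C.carrier) x).hom ⊗ₘ
        (Herm.pairing (C := C.carrier) y).hom) ≫ (chi x.obj y.obj).hom =
        𝟙 (x.obj ⊗ y.obj) ≫ 𝟙 _ ≫ (((Herm.pairing (C := C.carrier) x).hom ⊗ₘ
          (Herm.pairing (C := C.carrier) y).hom) ≫ (chi x.obj y.obj).hom) ≫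
          dMap (𝟙 (x.obj ⊗ y.obj))
      simp only [dMap_id, Category.comp_id, Category.id_comp]
    isBraided := fun hk x y =>
      ((Category.id_comp (C.braiding.beta hk x.obj y.obj).hom).trans
        (Category.comp_id (C.braiding.beta hk x.obj y.obj).hom).symm) }

end

/-- At `(c, h)` both composites have comparison isomorphism `φ_c ∘ F h`: on one side it is the
pairing that `hermMap F` puts on `F c`, on the other it is the composition formula for comparisons.
-/
lemma hermCounit_naturality {C C' : AICat.{v, max u v} k} (F : C ⟶ C') :
    canonicalMap (hermMap F) ≫ hermCounit C' = hermCounit C ≫ F :=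
  AICat.Hom.mk_eq
    ((Category.id_comp (Functor.LaxMonoidal.ε F.functor)).trans
      ((congrArg (_ ≫ ·) (F.functor.map_id _)).trans (Category.comp_id _)).symm)
    (funext fun x => funext fun y =>
      (Category.id_comp (Functor.LaxMonoidal.μ F.functor x.obj y.obj)).trans
      ((congrArg (_ ≫ ·) (F.functor.map_id _)).trans (Category.comp_id _)).symm)
    (fun x => Category.id_comp (F.functor.map x.unop.pairing.hom ≫ (F.phiApp x.unop.obj).hom))

/-- The shape of strict 2-naturality for the units and counits: both whiskerings have the same
component `h`, and the two `eqToHom` factors are identities on underlying objects. -/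
lemma whisker_eqToHom_aux {C : Type u} [Category.{v} C] {X Y : C} {f : Y ⟶ Y} {g : X ⟶ X}
    (hf : f = 𝟙 Y) (hg : g = 𝟙 X) (h : X ⟶ Y) : h ≫ f = g ≫ h := by
  rw [hf, hg, Category.id_comp, Category.comp_id]

/-- The canonical 2-functor is strictly left adjoint to the Hermitian completion. -/
def hermAdjunction (k : Level) :
    TwoAdjunction (canonical.{v, max u v} k) (hermTwoFunctor.{v, max u v} k) where
  unit :=
    { app := hermUnit
      naturality := hermUnit_naturality
      naturality₂ := fun {_ _ F G} τ => DagCat.hom₂_ext fun x => Herm.hom_ext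
        (whisker_eqToHom_aux (hermObj_eqToHom_app_hom (hermUnit_naturality G) x)
          (hermObj_eqToHom_app_hom (hermUnit_naturality F) x) (τ.toNatTrans.app x)) }
  counit :=
    { app := hermCounit
      naturality := hermCounit_naturality
      naturality₂ := fun {_ _ F G} τ => AICat.hom₂_ext fun x =>
        (whisker_eqToHom_aux (AICat.eqToHom_app (hermCounit_naturality G) x)
          (AICat.eqToHom_app (hermCounit_naturality F) x) (τ.toNatTrans.app x.obj)) }
  left_triangle D := AICat.Hom.mk_eq
    (Category.id_comp (𝟙 (𝟙_ D.carrier)))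
    (funext fun x => funext fun y => Category.id_comp (𝟙 (x ⊗ y : D.carrier)))
    -- The composite's comparison at `x` is the pairing of the unit's image `(x, id)`, hence
    -- trivial.
    (fun _ => Category.id_comp (𝟙 (_ : D.carrier)))
  right_triangle C := hermObj_ext
    -- The unit puts the identity pairing on `(c, h)`, and the counit's comparison turns it into `h
    -- ∘ id`, which recovers the original pairing.
    (fun _ => Herm.ext_pairing (Category.id_comp _))
    (fun _ => HEq.rfl)
    (heq_of_eq (Category.id_comp (𝟙 (𝟙_ C.carrier))))
    (fun x y => heq_of_eq (Category.id_comp (𝟙 (x.obj ⊗ y.obj : C.carrier))))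

/-! ### Corestriction to and inclusion of full dagger subcategories -/

lemma full_hom_heq {C : Type u} [Category.{v} C] {P : ObjectProperty C}
    {X X' Y Y' : P.FullSubcategory} (hX : X = X') (hY : Y = Y') {f : X ⟶ Y} {g : X' ⟶ Y'}
    (h : f.hom ≍ g.hom) : f ≍ g := by
  subst hX hY
  exact heq_of_eq (ObjectProperty.hom_ext _ (eq_of_heq h))

lemma full_obj_ext {C : Type u} {P : C → Prop} [Category.{v} C]
    {X Y : ObjectProperty.FullSubcategory P} (h : X.obj = Y.obj) : X = Y := by
  obtain ⟨X, hX⟩ := X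
  obtain ⟨Y, hY⟩ := Y
  obtain rfl : X = Y := h
  rfl

namespace DagCat

lemma full_ext {X E : DagCat.{v, u} k} {P : ObjectProperty E.carrier} [P.IsMonoidal]
    {F G : X ⟶ E.full P}
    (hobj : ∀ x, (F.functor.obj x).obj = (G.functor.obj x).obj)
    (hmap : ∀ {x y : X.carrier} (f : x ⟶ y), (F.functor.map f).hom ≍ (G.functor.map f).hom)
    (hε : (Functor.LaxMonoidal.ε F.functor).hom ≍ (Functor.LaxMonoidal.ε G.functor).hom)
    (hμ : ∀ x y, (Functor.LaxMonoidal.μ F.functor x y).hom ≍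
      (Functor.LaxMonoidal.μ G.functor x y).hom) : F = G :=
  have h : ∀ x, F.functor.obj x = G.functor.obj x := fun x => full_obj_ext (hobj x)
  DagCat.Hom.ext_heq h (fun f => full_hom_heq (h _) (h _) (hmap f))
    (full_hom_heq rfl (h _) hε)
    (fun x y => full_hom_heq
      (congrArg₂ (MonoidalCategoryStruct.tensorObj (C := P.FullSubcategory)) (h x) (h y))
      (h _) (hμ x y))

/-- A 1-morphism with values in a full dagger subcategory. -/
def corestrict {D E : DagCat.{v, u} k} (F : D ⟶ E) (Q : ObjectProperty E.carrier)
    [Q.IsMonoidal] (h : ∀ x, Q (F.functor.obj x)) : D ⟶ E.full Q :=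
  { functor := Q.lift F.functor h
    monoidal := Functor.CoreMonoidal.toMonoidal
      { εIso := Q.isoMk (Functor.Monoidal.εIso F.functor)
        μIso := fun x y => Q.isoMk (Functor.Monoidal.μIso F.functor x y)
        μIso_hom_natural_left := fun f z => ObjectProperty.hom_ext _
          (Functor.LaxMonoidal.μ_natural_left F.functor f z)
        μIso_hom_natural_right := fun z f => ObjectProperty.hom_ext _
          (Functor.LaxMonoidal.μ_natural_right F.functor z f)
        associativity := fun x y z => ObjectProperty.hom_ext _
          (Functor.LaxMonoidal.associativity F.functor x y z)
        left_unitality := fun x => ObjectProperty.hom_ext _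
          (Functor.LaxMonoidal.left_unitality F.functor x)
        right_unitality := fun x => ObjectProperty.hom_ext _
          (Functor.LaxMonoidal.right_unitality F.functor x) }
    map_dag := fun f => ObjectProperty.hom_ext _ (F.map_dag f)
    unitary_unit := full_isUnitary Q F.unitary_unit
    unitary_tensor := fun x y => full_isUnitary Q (F.unitary_tensor x y)
    isBraided := fun hk x y => ObjectProperty.hom_ext _ (F.isBraided hk x y) }

/-- The inclusion of a full dagger subcategory. -/
def inclusion (E : DagCat.{v, u} k) (Q : ObjectProperty E.carrier) [Q.IsMonoidal] :
    E.full Q ⟶ E :=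
  { functor := Q.ι
    monoidal := (inferInstance : Functor.Monoidal (C := Q.FullSubcategory) (D := E.carrier) Q.ι)
    map_dag := fun _ => rfl
    unitary_unit := IsUnitary.id (C := E.carrier) _
    unitary_tensor := fun _ _ => IsUnitary.id (C := E.carrier) _
    isBraided := fun hk x y =>
      (Category.id_comp (E.braiding.beta hk x.obj y.obj).hom).trans
        (Category.comp_id (E.braiding.beta hk x.obj y.obj).hom).symm }

lemma corestrict_inclusion {D E : DagCat.{v, u} k} (F : D ⟶ E) (Q : ObjectProperty E.carrier)
    [Q.IsMonoidal] (h : ∀ x, Q (F.functor.obj x)) :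
    corestrict F Q h ≫ inclusion E Q = F :=
  DagCat.Hom.mk_eq (Category.id_comp (Functor.LaxMonoidal.ε F.functor))
    (funext fun x => funext fun y => Category.id_comp (Functor.LaxMonoidal.μ F.functor x y))

/-- This naturality of the inclusions is what reduces naturality of the positive counit to
`hermCounit_naturality`. -/
lemma restrict_inclusion {D E : DagCat.{v, u} k} (F : D ⟶ E) (P : ObjectProperty D.carrier)
    [P.IsMonoidal] (Q : ObjectProperty E.carrier) [Q.IsMonoidal]
    (h : ∀ x, P x → Q (F.functor.obj x)) :
    restrict F P Q h ≫ inclusion E Q = inclusion D P ≫ F :=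
  DagCat.Hom.mk_eq
    ((Category.id_comp (Functor.LaxMonoidal.ε F.functor)).trans
      ((congrArg (_ ≫ ·) (F.functor.map_id _)).trans (Category.comp_id _)).symm)
    (funext fun x => funext fun y =>
      (Category.id_comp (Functor.LaxMonoidal.μ F.functor x.obj y.obj)).trans
      ((congrArg (_ ≫ ·) (F.functor.map_id _)).trans (Category.comp_id _)).symm)

end DagCat

/-! ### The strict 2-functor `(C, P) ↦ C_P` -/

/-- The full dagger subcategory of the Hermitian completion on the positive pairings. -/
abbrev hermPosObj (X : AIPosCat.{v, u} k) : DagCat.{v, max u v} k :=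
  (hermObj X.toAICat).full X.positive

lemma hermPosObj_ext {X : DagCat.{v, max u v} k} {Y : AIPosCat.{v, u} k} {F G : X ⟶ hermPosObj Y}
    (hobj : ∀ x, (F.functor.obj x).obj = (G.functor.obj x).obj)
    (hmap : ∀ {x y : X.carrier} (f : x ⟶ y),
      (F.functor.map f).hom.hom ≍ (G.functor.map f).hom.hom)
    (hε : (Functor.LaxMonoidal.ε F.functor).hom.hom ≍ (Functor.LaxMonoidal.ε G.functor).hom.hom)
    (hμ : ∀ x y, (Functor.LaxMonoidal.μ F.functor x y).hom.hom ≍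
      (Functor.LaxMonoidal.μ G.functor x y).hom.hom) : F = G :=
  DagCat.full_ext hobj (fun f => Herm.hom_heq (hobj _) (hobj _) (hmap f))
    (Herm.hom_heq rfl (hobj _) hε)
    (fun x y => Herm.hom_heq (congrArg₂ Herm.tensor (hobj x) (hobj y)) (hobj _) (hμ x y))

lemma hermPosObj_hom_ext {X : AIPosCat.{v, u} k} {x y : (hermPosObj X).carrier} {f g : x ⟶ y}
    (h : f.hom.hom = g.hom.hom) : f = g :=
  ObjectProperty.hom_ext _ (Herm.hom_ext h)

lemma hermPosObj_eqToHom_app_hom {X : DagCat.{v, max u v} k} {Y : AIPosCat.{v, u} k}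
    {F G : X ⟶ hermPosObj Y} (h : F = G) (x : X.carrier) :
    ((DagCat.Hom₂.toNatTrans (eqToHom h)).app x).hom.hom =
      eqToHom (congrArg (fun K : DagCat.Hom X (hermPosObj Y) => (K.functor.obj x).obj.obj) h) := by
  subst h
  rfl

lemma hermPos_map_comp {X Y Z : AIPosCat.{v, u} k} (F : X ⟶ Y) (G : Y ⟶ Z) :
    (hermPosData k).map (F ≫ G) = (hermPosData k).map F ≫ (hermPosData k).map G :=
  hermPosObj_ext (fun x => AIPosCat.hermFunctorObj_comp F.hom G.hom x.obj) (fun _ => HEq.rfl)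
    HEq.rfl fun _ _ => HEq.rfl

/-- The strict 2-functor `(C, P) ↦ C_P`. -/
def hermPosTwoFunctor (k : Level) :
    StrictPseudofunctor (AIPosCat.{v, u} k) (DagCat.{v, max u v} k) :=
  StrictPseudofunctor.mk''
    { toPrelaxFunctorStruct := hermPosData k
      map₂_id := fun _ => rfl
      map₂_comp := fun _ _ => rfl
      map_id := fun X => hermPosObj_ext
        (fun x => AIPosCat.hermFunctorObj_id X.toAICat x.obj) (fun _ => HEq.rfl)
        HEq.rfl fun _ _ => HEq.rfl
      map_comp := hermPos_map_comp
      map₂_whisker_left := fun {_ _ _} F {G H} τ => DagCat.hom₂_ext fun x => hermPosObj_hom_ext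
        (whisker_aux (hermPosObj_eqToHom_app_hom (hermPos_map_comp F G) x)
          (hermPosObj_eqToHom_app_hom (hermPos_map_comp F H).symm x)
          (τ.hom.toNatTrans.app (F.hom.functor.obj x.obj.obj)))
      map₂_whisker_right := fun {_ _ _ F G} τ H => DagCat.hom₂_ext fun x => hermPosObj_hom_ext
        (whisker_aux (hermPosObj_eqToHom_app_hom (hermPos_map_comp F H) x)
          (hermPosObj_eqToHom_app_hom (hermPos_map_comp G H).symm x)
          (H.hom.functor.map (τ.hom.toNatTrans.app x.obj.obj))) }

/-! ### The adjunction for positivity structures -/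

/-- A dagger category, regarded as an anti-involutive category with its canonical positivity
structure. -/
def canonicalPosObj (D : DagCat.{v, u} k) : AIPosCat.{v, u} k :=
  ⟨canonicalObj D, canonicalPositivity D⟩

/-- The unit of the adjunction between `D ↦ (D, Pos(D))` and `(C, P) ↦ C_P`. -/
def hermPosUnit (D : DagCat.{v, max u v} k) :
    D ⟶ hermPosObj (canonicalPosObj D) :=
  DagCat.corestrict (E := hermObj (canonicalPosObj D).toAICat) (hermUnit D) (AIPosCat.positive (canonicalPosObj D))
    (fun x => IsIsoPositive.id (C := D.carrier) x)

lemma hermPosUnit_naturality {D E : DagCat.{v, max u v} k} (F : D ⟶ E) :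
    F ≫ hermPosUnit E = hermPosUnit D ≫ (hermPosData k).map ((canonicalPos k).map F) :=
  hermPosObj_ext
    (fun x => Herm.ext_pairing (((Category.comp_id (F.functor.map (𝟙 x))).trans
      (F.functor.map_id x)).symm))
    (fun _ => HEq.rfl)
    (heq_of_eq ((Category.id_comp (Functor.LaxMonoidal.ε F.functor)).trans
      ((congrArg (_ ≫ ·) (F.functor.map_id _)).trans (Category.comp_id _)).symm))
    (fun x y => heq_of_eq ((Category.id_comp (Functor.LaxMonoidal.μ F.functor x y)).trans
      ((congrArg (_ ≫ ·) (F.functor.map_id _)).trans (Category.comp_id _)).symm))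

/-- The pairing induced on the underlying object by an iso-positive endomorphism of `(c, h)` is a
transfer of a positive pairing. -/
lemma hermCounit_positive (X : AIPosCat.{v, max u v} k)
    (x : Herm (canonicalObj (hermPosObj X)).carrier)
    (hx : (canonicalPositivity (hermPosObj X)).pos x) :
    X.positivity.pos (hermFunctorObj (canonicalMap (DagCat.inclusion (hermObj X.toAICat)
      X.positive) ≫ hermCounit X.toAICat) x) := by
  obtain ⟨c, p, hp⟩ := x
  obtain ⟨Z, g, hg : p.hom = g.hom ≫ dag g.hom⟩ := hx
  let e : c.obj.obj ≅ Z.obj.obj := (Herm.forget _).mapIso (X.positive.ι.mapIso g)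
  have h := X.positivity.transfer_mem Z.obj Z.property e
  -- Write `h` for the pairing of `c`, and `h'` for that of `Z`. The dagger of `g` is `h⁻¹ ∘ d g ∘
  -- h'`, so composing `g† ∘ g` with `h` cancels `h⁻¹` and leaves the transfer of `h'` along `g`.
  have h1 : p.hom.hom.hom ≫ c.obj.pairing.hom =
      e.hom ≫ Z.obj.pairing.hom ≫ dMap e.hom := by
    rw [hg]
    change (e.hom ≫ Z.obj.pairing.hom ≫ dMap e.hom ≫ c.obj.pairing.inv) ≫ _ = _
    simp
  refine cast (congrArg X.positivity.pos ?_) h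
  refine Herm.ext_pairing (h1.symm.trans ?_)
  -- The extra identity is the trivial comparison isomorphism of the inclusion, which precedes that
  -- of the counit in the composite.
  exact congrArg (p.hom.hom.hom ≫ ·) (Category.id_comp c.obj.pairing.hom).symm

/-- The counit of the adjunction between `D ↦ (D, Pos(D))` and `(C, P) ↦ C_P`. -/
def hermPosCounit (X : AIPosCat.{v, max u v} k) :
    canonicalPosObj (hermPosObj X) ⟶ X :=
  ⟨canonicalMap (DagCat.inclusion (hermObj X.toAICat) X.positive) ≫ hermCounit X.toAICat,
    hermCounit_positive X⟩

lemma hermPosCounit_naturality {X Y : AIPosCat.{v, max u v} k} (F : X ⟶ Y) :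
    (canonicalPos k).map ((hermPosData k).map F) ≫ hermPosCounit Y = hermPosCounit X ≫ F :=
  AIPosCat.hom_ext' (by
    change canonicalMap (DagCat.restrict (hermMap F.hom) X.positive Y.positive F.preserves) ≫
      canonicalMap (DagCat.inclusion (hermObj Y.toAICat) Y.positive) ≫ hermCounit Y.toAICat =
      (canonicalMap (DagCat.inclusion (hermObj X.toAICat) X.positive) ≫
        hermCounit X.toAICat) ≫ F.hom
    rw [← AICat.assoc', ← canonical_map_comp]
    -- After reassociation the restricted functor meets the inclusion; moving the inclusion to the
    -- front leaves the naturality square of the counit without positivity.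
    refine (congrArg (fun K => canonicalMap K ≫ hermCounit Y.toAICat)
      (DagCat.restrict_inclusion (hermMap F.hom) X.positive Y.positive F.preserves)).trans ?_
    rw [canonical_map_comp, AICat.assoc', AICat.assoc', hermCounit_naturality])

lemma AIPosCat.eqToHom_app {X Y : AIPosCat.{v, u} k} {F G : X ⟶ Y} (h : F = G)
    (x : X.toAICat.carrier) : (AIPosCat.Hom₂.hom (eqToHom h)).toNatTrans.app x =
      eqToHom (congrArg (fun K : AIPosCat.Hom X Y => K.hom.functor.obj x) h) := by
  subst h
  rfl

/-- The positive unit is a corestriction of `hermUnit` and the positive counit begins with the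
inclusion, so the two cancel and the left triangle of `hermAdjunction` remains. -/
lemma hermPos_left_triangle (D : DagCat.{v, max u v} k) :
    (canonicalPos k).map (hermPosUnit D) ≫ hermPosCounit (canonicalPosObj D) =
      𝟙 (canonicalPosObj D) :=
  AIPosCat.hom_ext' (by
    refine (AICat.assoc' (canonicalMap (hermPosUnit D)) (canonicalMap (DagCat.inclusion
      (hermObj (canonicalPosObj D).toAICat) (canonicalPosObj D).positive))
      (hermCounit (canonicalPosObj D).toAICat)).symm.trans ?_
    rw [← canonical_map_comp]
    exact (congrArg (fun K => canonicalMap K ≫ hermCounit (canonicalObj D))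
      (DagCat.corestrict_inclusion (E := hermObj (canonicalPosObj D).toAICat) (hermUnit D)
        (canonicalPosObj D).positive _)).trans
      ((hermAdjunction k).left_triangle D))

lemma hermPos_right_triangle (X : AIPosCat.{v, max u v} k) :
    hermPosUnit (hermPosObj X) ≫ (hermPosData k).map (hermPosCounit X) = 𝟙 (hermPosObj X) :=
  hermPosObj_ext
    (fun x => Herm.ext_pairing ((Category.id_comp _).trans (Category.id_comp _)))
    (fun _ => HEq.rfl)
    (heq_of_eq (by
      change (𝟙 (𝟙_ X.toAICat.carrier) ≫ 𝟙 (𝟙_ X.toAICat.carrier)) ≫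
        𝟙 (𝟙_ X.toAICat.carrier) = 𝟙 _
      simp))
    (fun x y => heq_of_eq (by
      change (𝟙 (x.obj.obj ⊗ y.obj.obj) ≫ 𝟙 (x.obj.obj ⊗ y.obj.obj)) ≫
        𝟙 (x.obj.obj ⊗ y.obj.obj) = 𝟙 _
      simp))

/-- The 2-functor `D ↦ (D, Pos(D))` is strictly left adjoint to `(C, P) ↦ C_P`. -/
def hermPosAdjunction (k : Level) :
    TwoAdjunction (canonicalPos.{v, max u v} k) (hermPosTwoFunctor.{v, max u v} k) where
  unit :=
    { app := hermPosUnit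
      naturality := hermPosUnit_naturality
      naturality₂ := fun {_ _ F G} τ => DagCat.hom₂_ext fun x => hermPosObj_hom_ext
        (whisker_eqToHom_aux (hermPosObj_eqToHom_app_hom (hermPosUnit_naturality G) x)
          (hermPosObj_eqToHom_app_hom (hermPosUnit_naturality F) x) (τ.toNatTrans.app x)) }
  counit :=
    { app := hermPosCounit
      naturality := hermPosCounit_naturality
      naturality₂ := fun {_ _ F G} τ => AIPosCat.hom₂_ext (AICat.hom₂_ext fun x =>
        (whisker_eqToHom_aux (AIPosCat.eqToHom_app (hermPosCounit_naturality G) x)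
          (AIPosCat.eqToHom_app (hermPosCounit_naturality F) x)
          (τ.hom.toNatTrans.app x.obj.obj))) }
  left_triangle := hermPos_left_triangle
  right_triangle := hermPos_right_triangle

/-! ### The unit components are equivalences -/

/-- For an invertible morphism a one-sided inverse is the inverse, so only one of the two unitarity
equations has to be checked. -/
lemma isUnitary_of_iso {C : Type u} [Category.{v} C] [DaggerCategory C] {X Y : C} (e : X ≅ Y)
    (h : e.hom ≫ dag e.hom = 𝟙 X) : IsUnitary e.hom :=
  (isUnitary_iff_dag_eq_inv e).2 (by rw [← cancel_epi e.hom, h, Iso.hom_inv_id])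

lemma dag_inv_comp_dag_hom {C : Type u} [Category.{v} C] [DaggerCategory C] {X Y : C}
    (e : X ≅ Y) : dag e.hom ≫ dag e.inv = 𝟙 Y := by
  rw [← dag_comp, Iso.inv_hom_id, dag_id]

/-- The bracket on the left is the dagger of `f` in the Hermitian completion, for the pairings `h =
g† ∘ g` and `h' = g'† ∘ g'`. Conjugation by the factors turns it into the dagger of `C`, because `g
∘ h⁻¹ = (g⁻¹)†`. This makes `rootFunctor` a dagger functor. -/
lemma conj_dag {C : Type u} [Category.{v} C] [DaggerCategory C] {X X' Y Y' : C} (g : X ≅ X')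
    (g' : Y ≅ Y') {h : X ≅ X} {h' : Y ≅ Y} (hg : h.hom = g.hom ≫ dag g.hom)
    (hg' : h'.hom = g'.hom ≫ dag g'.hom) (f : X ⟶ Y) :
    g'.inv ≫ (h'.hom ≫ dag f ≫ h.inv) ≫ g.hom = dag (g.inv ≫ f ≫ g'.hom) := by
  have e : h.inv ≫ g.hom = dag g.inv := by
    rw [Iso.inv_comp_eq, hg, Category.assoc, dag_inv_comp_dag_hom, Category.comp_id]
  rw [dag_comp, dag_comp]
  simp only [Category.assoc]
  rw [e, hg', Category.assoc, Iso.inv_hom_id_assoc]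

/-- Two factorizations `g† ∘ g` of the same positive pairing differ by a unitary. Here `g ⊗ g'` and
`g''` both factor the pairing on `X ⊗ Y`; `g''` is chosen independently, so nothing stronger than
unitarity can be expected of the tensor structure map. -/
lemma conj_tensor_isUnitary {C : Type u} [Category.{v} C] [MonoidalCategory C] [DaggerCategory C]
    [MonoidalDagger C] {X X' Y Y' Z : C} (g : X ≅ X') (g' : Y ≅ Y') (g'' : X ⊗ Y ≅ Z)
    (h : g''.hom ≫ dag g''.hom = (g.hom ≫ dag g.hom) ⊗ₘ (g'.hom ≫ dag g'.hom)) :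
    IsUnitary ((g.inv ⊗ₘ g'.inv) ≫ g''.hom) := by
  refine isUnitary_of_iso ((g.symm ⊗ᵢ g'.symm) ≪≫ g'') ?_
  change ((g.inv ⊗ₘ g'.inv) ≫ g''.hom) ≫ dag ((g.inv ⊗ₘ g'.inv) ≫ g''.hom) = _
  rw [dag_comp, MonoidalDagger.dag_tensorHom, Category.assoc, reassoc_of% h,
    tensorHom_comp_tensorHom, tensorHom_comp_tensorHom]
  simp only [Category.assoc, dag_inv_comp_dag_hom, Category.comp_id, Iso.inv_hom_id,
    id_tensorHom_id]

/-- This and the next three lemmas are the unit and tensor coherences of the two invertible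
2-morphisms for the unit, written in an arbitrary category once the root isomorphisms have been made
explicit. -/
lemma unit_aux {C : Type u} [Category.{v} C] {X Y Z : C} (a : X ≅ Y) (b : X ⟶ Z) :
    𝟙 X ≫ b = (𝟙 X ≫ a.hom) ≫ a.inv ≫ 𝟙 X ≫ b := by
  simp

lemma tensor_aux {C : Type u} [Category.{v} C] [MonoidalCategory C] {X X' Y Y' Z W : C}
    (a : X ≅ X') (b : Y ≅ Y') (c : X ⊗ Y ≅ Z) (d : X ⊗ Y ⟶ W) :
    𝟙 (X ⊗ Y) ≫ d = (a.hom ⊗ₘ b.hom) ≫ ((a.inv ⊗ₘ b.inv) ≫ 𝟙 (X ⊗ Y) ≫ c.hom) ≫ c.inv ≫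
      𝟙 (X ⊗ Y) ≫ d := by
  simp [tensorHom_comp_tensorHom_assoc]

lemma unit_inv_aux {C : Type u} [Category.{v} C] {X Y : C} (a : X ≅ Y) :
    (𝟙 X ≫ 𝟙 X ≫ a.hom) ≫ a.inv = 𝟙 X := by
  simp

lemma tensor_inv_aux {C : Type u} [Category.{v} C] {X Y Z : C} (a : X ⟶ Y) (b : Y ≅ Z) :
    (𝟙 X ≫ a ≫ 𝟙 Y ≫ b.hom) ≫ b.inv = a ≫ 𝟙 Y := by
  simp

/-- Naturality of the target braiding carries the equation from `F` to `G` after precomposing with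
the invertible `e_X ⊗ e_Y`. It transfers braidedness from `forgetPos`, where it is immediate, to
`rootFunctor`. -/
lemma BraidingData.isPreservedBy_of_iso {C : Type u₁} [Category.{v₁} C] [MonoidalCategory C]
    {D : Type u₂} [Category.{v₂} D] [MonoidalCategory D] {B : BraidingData k C}
    {B' : BraidingData k D} {F G : C ⥤ D} [F.Monoidal] [G.Monoidal] (e : F ≅ G)
    (he : NatTrans.IsMonoidal e.hom) (h : B.IsPreservedBy B' F) : B.IsPreservedBy B' G := by
  intro hk X Y
  have h1 := h hk X Y
  have h2 : (e.hom.app X ⊗ₘ e.hom.app Y) ≫ (B'.beta hk (G.obj X) (G.obj Y)).hom =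
      (B'.beta hk (F.obj X) (F.obj Y)).hom ≫ (e.hom.app Y ⊗ₘ e.hom.app X) :=
    letI := B'.braiding hk
    BraidedCategory.braiding_naturality (e.hom.app X) (e.hom.app Y)
  rw [← cancel_epi (e.hom.app X ⊗ₘ e.hom.app Y), ← reassoc_of% (he.tensor X Y), reassoc_of% h2,
    ← he.tensor Y X, ← reassoc_of% h1, e.hom.naturality]

/-! ### The inverse of the unit, from chosen factorizations of positive pairings -/

section

variable (D : DagCat.{v, max u v} k)

/-- The functor forgetting the positive pairing. -/
@[simps]
def forgetPos : (hermPosObj (canonicalPosObj D)).carrier ⥤ D.carrier where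
  obj x := x.obj.obj
  map f := f.hom.hom

instance forgetPosMonoidal : (forgetPos D).Monoidal :=
  Functor.CoreMonoidal.toMonoidal
    { εIso := Iso.refl (𝟙_ D.carrier)
      μIso := fun x y => Iso.refl (C := D.carrier) ((forgetPos D).obj x ⊗ (forgetPos D).obj y)
      μIso_hom_natural_left := fun {x y} f z => by
        change ((forgetPos D).map f ▷ (forgetPos D).obj z) ≫ 𝟙 _ =
          𝟙 _ ≫ ((forgetPos D).map f ▷ (forgetPos D).obj z)
        rw [Category.id_comp, Category.comp_id]
      μIso_hom_natural_right := fun {x y} z f => by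
        change ((forgetPos D).obj z ◁ (forgetPos D).map f) ≫ 𝟙 _ =
          𝟙 _ ≫ ((forgetPos D).obj z ◁ (forgetPos D).map f)
        rw [Category.id_comp, Category.comp_id]
      associativity := fun x y z => by
        change 𝟙 (_ ⊗ _) ▷ (forgetPos D).obj z ≫ 𝟙 _ ≫
          (α_ ((forgetPos D).obj x) ((forgetPos D).obj y) ((forgetPos D).obj z)).hom =
          (α_ _ _ _).hom ≫ (forgetPos D).obj x ◁ 𝟙 (_ ⊗ _) ≫ 𝟙 _
        simp
      left_unitality := fun x => by
        change (λ_ ((forgetPos D).obj x)).hom = 𝟙 (𝟙_ D.carrier) ▷ (forgetPos D).obj x ≫ 𝟙 _ ≫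
          (λ_ ((forgetPos D).obj x)).hom
        simp
      right_unitality := fun x => by
        change (ρ_ ((forgetPos D).obj x)).hom = (forgetPos D).obj x ◁ 𝟙 (𝟙_ D.carrier) ≫ 𝟙 _ ≫
          (ρ_ ((forgetPos D).obj x)).hom
        simp }

variable {D}

/-- An object `y` such that the positive pairing on `x` is `g† ∘ g` for some `g : x ≅ y`. -/
noncomputable def rootObj (x : (hermPosObj (canonicalPosObj D)).carrier) : D.carrier :=
  Exists.choose (show IsIsoPositive (C := D.carrier) (X := (forgetPos D).obj x)
    x.obj.pairing.hom from x.property)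

/-- An isomorphism `g` such that the positive pairing on `x` is `g† ∘ g`. -/
noncomputable def rootIso (x : (hermPosObj (canonicalPosObj D)).carrier) : (forgetPos D).obj x ≅ rootObj x :=
  Exists.choose (Exists.choose_spec (show IsIsoPositive (C := D.carrier)
    (X := (forgetPos D).obj x) x.obj.pairing.hom from x.property))

/-- The positive pairing on `x`, as an automorphism in `D`. -/
def posPairing (x : (hermPosObj (canonicalPosObj D)).carrier) :
    (forgetPos D).obj x ≅ (forgetPos D).obj x :=
  x.obj.pairing

lemma posPairing_hom (x : (hermPosObj (canonicalPosObj D)).carrier) :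
    (posPairing x).hom = (rootIso x).hom ≫ dag (rootIso x).hom :=
  Exists.choose_spec (Exists.choose_spec (show IsIsoPositive (C := D.carrier)
    (X := (forgetPos D).obj x) x.obj.pairing.hom from x.property))

variable (D) in
/-- The functor sending a positive pairing to a chosen object through which it factors. -/
noncomputable def rootFunctor : (hermPosObj (canonicalPosObj D)).carrier ⥤ D.carrier :=
  -- `forgetPos` itself need not respect daggers, since the dagger on its source is conjugated by
  -- the pairings. Replacing each object by the target of its root, and conjugating morphisms
  -- accordingly, corrects this.
  (forgetPos D).copyObj rootObj rootIso

variable (D) in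
/-- The isomorphism between the forgetful functor and `rootFunctor`. -/
noncomputable def rootNatIso : forgetPos D ≅ rootFunctor D :=
  (forgetPos D).isoCopyObj rootObj rootIso

noncomputable instance rootMonoidal : (rootFunctor D).Monoidal := Functor.Monoidal.transport (rootNatIso D)

lemma rootFunctor_ε : Functor.LaxMonoidal.ε (rootFunctor D) = (rootIso (𝟙_ _)).hom :=
  Category.id_comp _

lemma rootFunctor_μ (x y : (hermPosObj (canonicalPosObj D)).carrier) :
    Functor.LaxMonoidal.μ (rootFunctor D) x y =
      ((rootIso x).inv ⊗ₘ (rootIso y).inv) ≫ (rootIso (x ⊗ y)).hom :=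
  congrArg (((rootIso x).inv ⊗ₘ (rootIso y).inv) ≫ ·) (Category.id_comp (rootIso (x ⊗ y)).hom)

variable (D) in
/-- The inverse of the unit of the adjunction. -/
noncomputable def hermPosUnitInv : hermPosObj (canonicalPosObj D) ⟶ D :=
  { functor := rootFunctor D
    monoidal := rootMonoidal
    map_dag := fun {x y} f =>
      conj_dag (rootIso x) (rootIso y) (posPairing_hom x) (posPairing_hom y) ((forgetPos D).map f)
    unitary_unit := by
      rw [rootFunctor_ε]
      -- The pairing on the monoidal unit is `u`, an identity here, so its root is an isometry.
      exact isUnitary_of_iso (C := D.carrier) _ (posPairing_hom (D := D) (𝟙_ _)).symm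
    unitary_tensor := fun x y => by
      rw [rootFunctor_μ]
      refine conj_tensor_isUnitary (rootIso x) (rootIso y) (rootIso (x ⊗ y)) ?_
      rw [← posPairing_hom x, ← posPairing_hom y]
      -- The pairing on `x ⊗ y` is `χ` after the tensor product of the pairings, and `χ` is an
      -- identity here.
      exact (posPairing_hom (x ⊗ y)).symm.trans
        (Category.comp_id ((posPairing x).hom ⊗ₘ (posPairing y).hom))
    isBraided := BraidingData.isPreservedBy_of_iso (rootNatIso D)
      (Functor.Monoidal.natTransIsMonoidal_of_transport (rootNatIso D))
      (fun hk x y => (Category.id_comp (D.braiding.beta hk _ _).hom).trans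
        (Category.comp_id (D.braiding.beta hk _ _).hom).symm) }

variable (D) in
/-- The identity of `D` is isomorphic to the unit followed by its inverse. -/
noncomputable def hermPosUnitIso : 𝟙 D ≅ hermPosUnit D ≫ hermPosUnitInv D :=
  DagCat.isoMk _ _
    (NatIso.ofComponents (F := 𝟭 D.carrier) (G := (hermPosUnit D).functor ⋙ rootFunctor D)
      (fun x => rootIso ((hermPosUnit D).functor.obj x))
      (fun {x y} f => (Iso.hom_inv_id_assoc (rootIso ((hermPosUnit D).functor.obj x))
        (f ≫ (rootIso ((hermPosUnit D).functor.obj y)).hom)).symm))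
    { unit := by
        change 𝟙 (𝟙_ D.carrier) ≫ (rootIso ((hermPosUnit D).functor.obj (𝟙_ D.carrier))).hom =
          (𝟙 _ ≫ (rootIso (𝟙_ _)).hom) ≫ (rootIso (𝟙_ _)).inv ≫ 𝟙 (𝟙_ D.carrier) ≫
            (rootIso ((hermPosUnit D).functor.obj (𝟙_ D.carrier))).hom
        exact unit_aux _ _
      tensor := fun x y => by
        let U := (hermPosUnit D).functor
        change 𝟙 (x ⊗ y) ≫ (rootIso (U.obj (x ⊗ y))).hom =
          ((rootIso (U.obj x)).hom ⊗ₘ (rootIso (U.obj y)).hom) ≫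
            (((rootIso (U.obj x)).inv ⊗ₘ (rootIso (U.obj y)).inv) ≫ 𝟙 (x ⊗ y) ≫
              (rootIso (U.obj x ⊗ U.obj y)).hom) ≫ (rootIso (U.obj x ⊗ U.obj y)).inv ≫
              𝟙 (x ⊗ y) ≫ (rootIso (U.obj (x ⊗ y))).hom
        exact tensor_aux _ _ _ _ }
    -- The root chosen for `(x, id)` need not be the identity, but it satisfies `g† ∘ g = id`, which
    -- is the required isometry condition.
    (fun x => (posPairing_hom ((hermPosUnit D).functor.obj x)).symm)

variable (D) in
/-- The inverse of the unit followed by the unit is isomorphic to the identity. -/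
noncomputable def hermPosUnitInvIso : hermPosUnitInv D ≫ hermPosUnit D ≅ 𝟙 (hermPosObj (canonicalPosObj D)) :=
  DagCat.isoMk _ _
    (NatIso.ofComponents
      (F := rootFunctor D ⋙ (hermPosUnit D).functor)
      (G := 𝟭 _)
      (fun x => (canonicalPosObj D).positive.isoMk (Herm.isoMk (rootIso x).symm))
      (fun {x y} f => hermPosObj_hom_ext (by
        change ((rootIso x).inv ≫ (forgetPos D).map f ≫ (rootIso y).hom) ≫ (rootIso y).inv =
          (rootIso x).inv ≫ (forgetPos D).map f
        rw [Category.assoc, Category.assoc, Iso.hom_inv_id, Category.comp_id])))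
    { unit := hermPosObj_hom_ext (unit_inv_aux (C := D.carrier) (rootIso (𝟙_ _)))
      tensor := fun x y => hermPosObj_hom_ext (tensor_inv_aux (C := D.carrier)
        ((rootIso x).inv ⊗ₘ (rootIso y).inv) (rootIso (x ⊗ y))) }
    (fun x => hermPosObj_hom_ext (by
      change (rootIso x).inv ≫ (posPairing x).hom ≫ dag (rootIso x).inv ≫ 𝟙 _ = 𝟙 _
      -- The component is `g⁻¹ : (y, id) → (x, g† ∘ g)`, whose dagger is `(g⁻¹)† ∘ g† ∘ g`;
      -- composing with `g⁻¹` first leaves `(g⁻¹)† ∘ g† = id`.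
      rw [posPairing_hom, Category.assoc, Iso.inv_hom_id_assoc, Category.comp_id,
        dag_inv_comp_dag_hom]))

end

/-- An internal equivalence also carries a triangle identity. Adjusting the counit `e'` makes it
hold, so no compatibility between `e` and `e'` is needed. -/
lemma isEquivalence_of_iso {B : Type u₁} [Bicategory.{v, v₁} B] {X Y : B} {f : X ⟶ Y} {g : Y ⟶ X}
    (e : 𝟙 X ≅ f ≫ g) (e' : g ≫ f ≅ 𝟙 Y) : IsEquivalence f :=
  ⟨Bicategory.Equivalence.mkOfAdjointifyCounit e e', rfl⟩

/-! ### The counit components are equivalences -/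

section

variable (X : AIPosCat.{v, u} k)

/-- The positivity axiom gives a pairing on an object merely equal to `c`. Moving it to `c` itself
lets the chosen functor be the identity on underlying objects. -/
lemma exists_positive_pairing (c : X.toAICat.carrier) :
    ∃ (h : c ≅ dObj c) (hh : IsHermitian h), X.positivity.pos ⟨c, h, hh⟩ := by
  obtain ⟨⟨_, h, hh⟩, hx, rfl⟩ := X.positivity.exists_pos c
  exact ⟨h, hh, hx⟩

/-- An object of `C`, equipped with a chosen positive pairing. -/
noncomputable def chosenObj (c : X.toAICat.carrier) : (hermPosObj X).carrier :=
  ⟨⟨c, (exists_positive_pairing X c).choose, (exists_positive_pairing X c).choose_spec.choose⟩,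
    (exists_positive_pairing X c).choose_spec.choose_spec⟩

/-- The chosen positive pairing on an object of `C`. -/
noncomputable def chosenPairing {X : AIPosCat.{v, u} k} (c : X.toAICat.carrier) : c ≅ dObj c :=
  (chosenObj X c).obj.pairing

lemma chosenPairing_hermitian {X : AIPosCat.{v, u} k} (c : X.toAICat.carrier) :
    etaApp c ≫ dMap (chosenPairing c).hom = (chosenPairing c).hom :=
  (chosenObj X c).obj.hermitian

/-- The functor equipping each object with a chosen positive pairing. -/
noncomputable def chosenFunctor : X.toAICat.carrier ⥤ (hermPosObj X).carrier where
  obj := chosenObj X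
  map f := ⟨⟨f⟩⟩

noncomputable instance chosenMonoidal : (chosenFunctor X).Monoidal :=
  Functor.CoreMonoidal.toMonoidal
    -- The chosen pairing on `x ⊗ y` may differ from the tensor product of the chosen pairings, so
    -- these identities of `C` need not be unitary in `C_P`. Only an anti-involutive functor is
    -- wanted, and its comparison isomorphisms absorb the difference.
    { εIso := X.positive.isoMk (Herm.isoMk (Iso.refl (𝟙_ X.toAICat.carrier)))
      μIso := fun x y => X.positive.isoMk (Herm.isoMk (Iso.refl (x ⊗ y)))
      μIso_hom_natural_left := fun {x y} f z => hermPosObj_hom_ext (by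
        change (f ▷ z) ≫ 𝟙 (y ⊗ z) = 𝟙 (x ⊗ z) ≫ f ▷ z
        simp)
      μIso_hom_natural_right := fun {x y} z f => hermPosObj_hom_ext (by
        change (z ◁ f) ≫ 𝟙 (z ⊗ y) = 𝟙 (z ⊗ x) ≫ z ◁ f
        simp)
      associativity := fun x y z => hermPosObj_hom_ext (by
        change 𝟙 (x ⊗ y) ▷ z ≫ 𝟙 ((x ⊗ y) ⊗ z) ≫ (α_ x y z).hom =
          (α_ x y z).hom ≫ x ◁ 𝟙 (y ⊗ z) ≫ 𝟙 (x ⊗ y ⊗ z)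
        simp)
      left_unitality := fun x => hermPosObj_hom_ext (by
        change (λ_ x).hom = 𝟙 (𝟙_ X.toAICat.carrier) ▷ x ≫
          𝟙 (𝟙_ X.toAICat.carrier ⊗ x) ≫ (λ_ x).hom
        simp)
      right_unitality := fun x => hermPosObj_hom_ext (by
        change (ρ_ x).hom = x ◁ 𝟙 (𝟙_ X.toAICat.carrier) ≫
          𝟙 (x ⊗ 𝟙_ X.toAICat.carrier) ≫ (ρ_ x).hom
        simp) }

end

/-! ### The inverse of the counit, from chosen positive pairings -/

section

variable (X : AIPosCat.{v, max u v} k)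

/-- The inverse of the counit of the adjunction, as an anti-involutive functor: the comparison
isomorphism on `c` is the inverse of the chosen positive pairing. -/
noncomputable def hermPosCounitInvHom : X.toAICat ⟶ canonicalObj (hermPosObj X) :=
  { functor := chosenFunctor X
    monoidal := chosenMonoidal X
    phi := NatIso.ofComponents
      (fun c => X.positive.isoMk (X := chosenObj X (dObj (unop c))) (Y := chosenObj X (unop c))
        (Herm.isoMk (chosenPairing (unop c)).symm))
      (fun {c c'} f => hermPosObj_hom_ext (by
        change dMap f.unop ≫ (chosenPairing (unop c')).inv = (chosenPairing (unop c)).inv ≫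
          (chosenPairing (unop c)).hom ≫ dMap f.unop ≫ (chosenPairing (unop c')).inv
        rw [Iso.inv_hom_id_assoc]))
    phi_eta := fun c => hermPosObj_hom_ext (by
      change etaApp c ≫ (chosenPairing (dObj c)).inv = 𝟙 c ≫ (chosenPairing c).hom ≫
        dMap (chosenPairing c).inv ≫ (chosenPairing (dObj c)).inv
      -- Replacing the pairing `h` on `c` by `d h ∘ η_c` leaves `d h` next to `d(h⁻¹)`; they cancel,
      -- and the pairing chosen on `dObj c` appears equally on both sides.
      rw [← chosenPairing_hermitian c]
      simp only [Category.assoc]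
      rw [← reassoc_of% (dMap_comp (chosenPairing c).inv (chosenPairing c).hom), Iso.inv_hom_id,
        dMap_id, Category.id_comp, Category.id_comp])
    phi_unit := hermPosObj_hom_ext (by
      change 𝟙 (𝟙_ X.toAICat.carrier) ≫ (uIso X.toAICat.carrier).hom ≫
        (chosenPairing (𝟙_ X.toAICat.carrier)).inv ≫
        (chosenPairing (𝟙_ X.toAICat.carrier)).hom ≫ dMap (𝟙 (𝟙_ X.toAICat.carrier)) ≫
        (uIso X.toAICat.carrier).inv = 𝟙 _
      rw [dMap_id, Category.id_comp, Category.id_comp, Iso.inv_hom_id_assoc, Iso.hom_inv_id])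
    phi_tensor := fun x y => hermPosObj_hom_ext (by
      change ((chosenPairing x).inv ⊗ₘ (chosenPairing y).inv) ≫ 𝟙 (x ⊗ y) =
        𝟙 (dObj x ⊗ dObj y) ≫ (chi x y).hom ≫ (chosenPairing (x ⊗ y)).inv ≫
        (chosenPairing (x ⊗ y)).hom ≫ dMap (𝟙 (x ⊗ y)) ≫ (chi x y).inv ≫
        ((chosenPairing x).inv ⊗ₘ (chosenPairing y).inv)
      -- The pairing chosen on `x ⊗ y` cancels: it enters inverted through the comparison
      -- isomorphism and directly through the dagger of the structure map.
      rw [dMap_id, Category.id_comp, Category.id_comp, Iso.inv_hom_id_assoc,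
        Iso.hom_inv_id_assoc, Category.comp_id])
    isBraided := fun hk x y => hermPosObj_hom_ext
      ((Category.id_comp (X.toAICat.braiding.beta hk x y).hom).trans
        (Category.comp_id (X.toAICat.braiding.beta hk x y).hom).symm) }

/-- The inverse of the counit of the adjunction. -/
noncomputable def hermPosCounitInv : X ⟶ canonicalPosObj (hermPosObj X) :=
  ⟨hermPosCounitInvHom X, fun x hx =>
    -- For a positive `(c, h)` and chosen pairing `k`, the image pairing is `k⁻¹ ∘ h`. This is `g† ∘
    -- g` for `g` the identity of `c` seen as a morphism `(c, k) → (c, h)`; positivity of `h` is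
    -- what places its target in `C_P`.
    ⟨⟨x, hx⟩, X.positive.isoMk (X := chosenObj X x.obj) (Y := ⟨x, hx⟩)
      (Herm.isoMk (X := (chosenObj X x.obj).obj) (Y := x) (Iso.refl x.obj)),
      hermPosObj_hom_ext (by
        change x.pairing.hom ≫ (chosenPairing x.obj).inv =
          𝟙 x.obj ≫ x.pairing.hom ≫ dMap (𝟙 x.obj) ≫ (chosenPairing x.obj).inv
        rw [dMap_id, Category.id_comp, Category.id_comp])⟩⟩

/-- The identity is isomorphic to the counit followed by its inverse. -/
noncomputable def hermPosCounitIso :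
    𝟙 (canonicalPosObj (hermPosObj X)) ≅ hermPosCounit X ≫ hermPosCounitInv X :=
  AIPosCat.isoMk _ _ (AICat.isoOfId _ _
    (NatIso.ofComponents (F := 𝟭 (hermPosObj X).carrier)
      (G := (hermPosCounit X).hom.functor ⋙ chosenFunctor X)
      (fun x => X.positive.isoMk (X := x) (Y := chosenObj X x.obj.obj)
        (Herm.isoMk (X := x.obj) (Y := (chosenObj X x.obj.obj).obj) (Iso.refl x.obj.obj)))
      (fun f => hermPosObj_hom_ext
        ((Category.comp_id f.hom.hom).trans (Category.id_comp f.hom.hom).symm)))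
    { unit := hermPosObj_hom_ext (by
        change 𝟙 (𝟙_ X.toAICat.carrier) ≫ 𝟙 (𝟙_ X.toAICat.carrier) =
          𝟙 (𝟙_ X.toAICat.carrier) ≫ 𝟙 (𝟙_ X.toAICat.carrier) ≫ 𝟙 (𝟙_ X.toAICat.carrier)
        simp only [Category.comp_id])
      tensor := fun x y => hermPosObj_hom_ext (by
        change 𝟙 (x.obj.obj ⊗ y.obj.obj) ≫ 𝟙 (x.obj.obj ⊗ y.obj.obj) =
          (𝟙 x.obj.obj ⊗ₘ 𝟙 y.obj.obj) ≫ 𝟙 (x.obj.obj ⊗ y.obj.obj) ≫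
            𝟙 (x.obj.obj ⊗ y.obj.obj) ≫ 𝟙 (x.obj.obj ⊗ y.obj.obj)
        simp only [Category.comp_id, id_tensorHom_id]) }
    (fun x => hermPosObj_hom_ext (by
      -- The component is the identity of `c` from `(c, h)` to `(c, k)`, with `k` the chosen
      -- pairing. The comparison of the composite is `k⁻¹ ∘ h` and the dagger of the component is
      -- `h⁻¹ ∘ k`, so the two cancel.
      change 𝟙 x.obj.obj = 𝟙 x.obj.obj ≫ ((𝟙 x.obj.obj ≫ x.obj.pairing.hom) ≫
        (chosenPairing x.obj.obj).inv) ≫ (chosenPairing x.obj.obj).hom ≫ dMap (𝟙 x.obj.obj) ≫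
        x.obj.pairing.inv
      simp only [dMap_id, Category.id_comp, Category.assoc, Iso.inv_hom_id_assoc,
        Iso.hom_inv_id])))

/-- The inverse of the counit followed by the counit is isomorphic to the identity. -/
noncomputable def hermPosCounitInvIso : hermPosCounitInv X ≫ hermPosCounit X ≅ 𝟙 X :=
  AIPosCat.isoMk _ _ (AICat.isoOfId _ _
    (NatIso.ofComponents
      (F := chosenFunctor X ⋙ (hermPosCounit X).hom.functor)
      (G := 𝟭 X.toAICat.carrier)
      (fun c => Iso.refl c)
      (fun f => (Category.comp_id f).trans (Category.id_comp f).symm))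
    { unit := by
        change ((𝟙 (𝟙_ X.toAICat.carrier) ≫ 𝟙 (𝟙_ X.toAICat.carrier)) ≫
          𝟙 (𝟙_ X.toAICat.carrier)) ≫ 𝟙 (𝟙_ X.toAICat.carrier) = 𝟙 (𝟙_ X.toAICat.carrier)
        simp only [Category.comp_id]
      tensor := fun x y => by
        change ((𝟙 (x ⊗ y) ≫ 𝟙 (x ⊗ y)) ≫ 𝟙 (x ⊗ y)) ≫ 𝟙 (x ⊗ y) = (𝟙 x ⊗ₘ 𝟙 y) ≫ 𝟙 (x ⊗ y)
        simp only [Category.comp_id, id_tensorHom_id] }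
    (fun c => by
      -- The inverse contributes the inverse of the chosen pairing and the counit the pairing
      -- itself, so the composite has trivial comparison.
      change (chosenPairing c).inv ≫ 𝟙 c ≫ (chosenPairing c).hom =
        𝟙 (dObj c) ≫ 𝟙 (dObj c) ≫ dMap (𝟙 c)
      simp only [dMap_id, Category.id_comp, Iso.inv_hom_id]))

end

end DaggerHerm

/-- In the monoidal, braided monoidal and symmetric monoidal settings: the Hermitian completion is
a strict 2-functor, right adjoint to the canonical 2-functor from dagger categories to
anti-involutive categories, and `(C, P) ↦ C_P`, `D ↦ (D, Pos(D))` is a 2-equivalence. -/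
theorem mainTheorem3 (k : DaggerHerm.Level) :
    (∃ H : StrictPseudofunctor (DaggerHerm.AICat.{v, max u v} k)
        (DaggerHerm.DagCat.{v, max u v} k),
      H.toPrelaxFunctorStruct = DaggerHerm.hermData k ∧
      Nonempty (DaggerHerm.TwoAdjunction (DaggerHerm.canonical k) H)) ∧
    (∃ HP : StrictPseudofunctor (DaggerHerm.AIPosCat.{v, max u v} k)
        (DaggerHerm.DagCat.{v, max u v} k),
      HP.toPrelaxFunctorStruct = DaggerHerm.hermPosData k ∧
      ∃ E : DaggerHerm.TwoAdjunction (DaggerHerm.canonicalPos k) HP,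
        (∀ D, DaggerHerm.IsEquivalence (E.unit.app D)) ∧
        (∀ C, DaggerHerm.IsEquivalence (E.counit.app C))) :=
  ⟨⟨DaggerHerm.hermTwoFunctor.{v, max u v} k, rfl, ⟨DaggerHerm.hermAdjunction.{v, u} k⟩⟩,
    DaggerHerm.hermPosTwoFunctor.{v, max u v} k, rfl, DaggerHerm.hermPosAdjunction.{v, u} k,
    fun D => DaggerHerm.isEquivalence_of_iso (DaggerHerm.hermPosUnitIso.{v, u} D)
      (DaggerHerm.hermPosUnitInvIso.{v, u} D),
    fun C => DaggerHerm.isEquivalence_of_iso (DaggerHerm.hermPosCounitIso.{v, u} C)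
      (DaggerHerm.hermPosCounitInvIso.{v, u} C)⟩
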